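/- Let $1\le p<\infty$, $p\ne 2$, and let $H^p$ be the Hardy space of the open unit disc $D$: the analytic functions $f$ on $D$ with $\|f\|_p=\sup_{0<r<1}\left(\int_T|f(r\zeta)|^p\,dm(\zeta)\right)^{1/p}<\infty$, where $m$ is normalized Lebesgue measure on the unit circle $T$. Let $\mathbb A$ be the group of automorphisms $\phi(z)=\frac{\lambda(z-a)}{1-\overline a z}$ of $D$, with $a\in D$ and $|\lambda|=1$. For such a $\phi$ put $U_\phi f=(\overline\lambda\,\phi')^{1/p}\,(f\circ\phi)$ (principal branch of the power), and for $\psi\in\mathbb A$ let $M_\psi f=\psi f$. An isometry $S$ of $H^p$ into itself whose range has codimension one is called Crownover if $\bigcap_{n=1}^\infty S^nH^p=(0)$. An automorphism $\phi\in\mathbb A$ other than the identity is called hyperbolic if it has two distinct fixed points on $T$; $\phi_n$ denotes the $n$-fold composition of $\phi$ with itself. Proposition 4. Let $\phi\in\mathbb A$ be hyperbolic and let $\psi\in\mathbb A$ be arbitrary. Then $\sum_{n=0}^\infty(1-|\phi_n(c)|)<\infty$ for every $c\in D$, and $M_\psi U_\phi$ is an isometry of $H^p$ into itself of codimension one which is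 not Crownover; that is, $\bigcap_{n=1}^\infty (M_\psi U_\phi)^nH^p\ne(0)$. -/

import Mathlib

open MeasureTheory
open scoped ENNReal ComplexConjugate Complex.UnitDisc

noncomputable section

namespace HardyDisc

/-! ### The Hardy spaces of the unit disc -/

/-- `f : 𝔻 → ℂ` is analytic on the open unit disc. -/
def IsAnalytic (f : 𝔻 → ℂ) : Prop :=
  ∃ F : ℂ → ℂ, DifferentiableOn ℂ F (Metric.ball 0 1) ∧ ∀ z : 𝔻, f z = F z

lemma IsAnalytic.continuous {f : 𝔻 → ℂ} (hf : IsAnalytic f) : Continuous f := by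
  obtain ⟨F, hF, h⟩ := hf
  have : f = fun z : 𝔻 => F z := funext h
  rw [this]
  exact hF.continuousOn.comp_continuous Complex.UnitDisc.continuous_coe
    (fun z => by simpa using z.norm_lt_one)

/-- The point `r * exp (i θ)` of the disc, for `0 < r < 1`. -/
def circlePt (r : Set.Ioo (0 : ℝ) 1) (θ : ℝ) : 𝔻 :=
  Complex.UnitDisc.mk (circleMap 0 r θ) (by
    simpa [abs_of_pos r.2.1] using r.2.2)

lemma continuous_circlePt (r : Set.Ioo (0 : ℝ) 1) : Continuous (circlePt r) :=
  Complex.UnitDisc.isEmbedding_coe.continuous_iff.2 (continuous_circleMap 0 r)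

/-- Normalized Lebesgue measure on the unit circle, in the angular coordinate
`θ ∈ (0, 2π]`. -/
def circleMeasure : Measure ℝ :=
  ENNReal.ofReal (2 * Real.pi)⁻¹ • volume.restrict (Set.Ioc 0 (2 * Real.pi))

/-- `(∫_T |f(rζ)|^p dm(ζ))^(1/p)`. -/
def circleNorm (p : ℝ≥0∞) (f : 𝔻 → ℂ) (r : Set.Ioo (0 : ℝ) 1) : ℝ≥0∞ :=
  eLpNorm (fun θ => f (circlePt r θ)) p circleMeasure

/-- The `H^p` norm `sup_{0<r<1} (∫_T |f(rζ)|^p dm(ζ))^(1/p)`, with values in `[0, ∞]`. -/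
def hardyENorm (p : ℝ≥0∞) (f : 𝔻 → ℂ) : ℝ≥0∞ :=
  ⨆ r : Set.Ioo (0 : ℝ) 1, circleNorm p f r

lemma hardyENorm_add_le {p : ℝ≥0∞} (hp : 1 ≤ p) {f g : 𝔻 → ℂ}
    (hf : Continuous f) (hg : Continuous g) :
    hardyENorm p (f + g) ≤ hardyENorm p f + hardyENorm p g := by
  refine iSup_le fun r => ?_
  refine (eLpNorm_add_le (f := fun θ => f (circlePt r θ)) (g := fun θ => g (circlePt r θ))
    (hf.comp (continuous_circlePt r)).aestronglyMeasurable
    (hg.comp (continuous_circlePt r)).aestronglyMeasurable hp).trans ?_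
  exact add_le_add (le_iSup (circleNorm p f) r) (le_iSup (circleNorm p g) r)

lemma hardyENorm_smul (p : ℝ≥0∞) (c : ℂ) (f : 𝔻 → ℂ) :
    hardyENorm p (c • f) = ‖c‖ₑ * hardyENorm p f := by
  unfold hardyENorm
  rw [ENNReal.mul_iSup]
  exact iSup_congr fun r => eLpNorm_const_smul c (fun θ => f (circlePt r θ)) p circleMeasure

lemma hardyENorm_zero (p : ℝ≥0∞) : hardyENorm p 0 = 0 := by
  simpa using hardyENorm_smul p 0 0

lemma exists_circlePt (z : 𝔻) (hz : z ≠ 0) :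
    ∃ r, ∃ θ ∈ Set.Ioc 0 (2 * Real.pi), circlePt r θ = z := by
  have h0 : 0 < ‖(z : ℂ)‖ := by simpa using hz
  refine ⟨⟨‖(z : ℂ)‖, h0, z.norm_lt_one⟩, ?_⟩
  have hmem : (z : ℂ) ∈ circleMap 0 ‖(z : ℂ)‖ '' Set.Ioc 0 (2 * Real.pi) := by
    rw [image_circleMap_Ioc]
    simp
  obtain ⟨θ, hθ, h⟩ := hmem
  exact ⟨θ, hθ, Complex.UnitDisc.coe_injective h⟩

lemma eq_zero_of_hardyENorm {p : ℝ≥0∞} (hp : 1 ≤ p) {f : 𝔻 → ℂ} (hf : Continuous f)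
    (h : hardyENorm p f = 0) : f = 0 := by
  have key : ∀ z : 𝔻, z ≠ 0 → f z = 0 := by
    intro z hz
    obtain ⟨r, θ, hθ, rfl⟩ := exists_circlePt z hz
    have hc : Continuous fun θ => f (circlePt r θ) := hf.comp (continuous_circlePt r)
    have h1 : circleNorm p f r = 0 :=
      le_antisymm (h ▸ le_iSup (circleNorm p f) r) bot_le
    have h2 := (eLpNorm_eq_zero_iff hc.aestronglyMeasurable
      (zero_lt_one.trans_le hp).ne').1 h1
    have h3 : (fun θ => f (circlePt r θ)) =ᵐ[volume.restrict (Set.Ioc 0 (2 * Real.pi))]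
        (fun _ => (0 : ℂ)) := by
      refine (Measure.ae_ennreal_smul_measure_iff ?_).1 h2
      simp [Real.pi_pos]
    exact Measure.eqOn_Ioc_of_ae_eq volume h3 hc.continuousOn continuousOn_const hθ
  have hset : Set.EqOn f 0 (closure {z : 𝔻 | z ≠ 0}) :=
    Set.EqOn.closure (fun z hz => key z hz) hf continuous_const
  have hcl : (0 : 𝔻) ∈ closure {z : 𝔻 | z ≠ 0} := by
    have ht : Filter.Tendsto (fun n : ℕ => Complex.UnitDisc.mk (1 / ((n : ℂ) + 2)) (by
        have h4 : (0 : ℝ) < (n : ℝ) + 2 := by positivity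
        have h5 : ‖(n : ℂ) + 2‖ = (n : ℝ) + 2 := by
          rw [← Complex.ofReal_natCast, ← Complex.ofReal_ofNat, ← Complex.ofReal_add,
            Complex.norm_real, Real.norm_of_nonneg h4.le]
        rw [norm_div, norm_one, h5, div_lt_one h4]
        have : (0 : ℝ) ≤ n := n.cast_nonneg
        linarith)) Filter.atTop (nhds (0 : 𝔻)) := by
      rw [Complex.UnitDisc.isEmbedding_coe.tendsto_nhds_iff]
      have h6 := (tendsto_one_div_add_atTop_nhds_zero_nat (𝕜 := ℂ)).comp
        (Filter.tendsto_add_atTop_nat 1)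
      refine h6.congr fun n => ?_
      simp only [Function.comp, Complex.UnitDisc.coe_mk]
      push_cast
      ring
    refine mem_closure_of_tendsto ht (Filter.Eventually.of_forall fun n => ?_)
    have h7 : (n : ℂ) + 2 ≠ 0 := by
      have : ((n + 2 : ℕ) : ℂ) ≠ 0 := Nat.cast_ne_zero.2 (by omega)
      simpa using this
    simpa using h7
  funext z
  by_cases hz : z = 0
  · rw [hz]; exact hset hcl
  · exact key z hz

/-- The analytic functions on the disc with finite `H^p` norm, as a subspace of all
functions on the disc. -/
def hardySubmodule (p : ℝ≥0∞) [hp : Fact (1 ≤ p)] : Submodule ℂ (𝔻 → ℂ) where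
  carrier := {f | IsAnalytic f ∧ hardyENorm p f < ∞}
  zero_mem' := ⟨⟨0, differentiableOn_const 0, fun _ => rfl⟩, by
    rw [hardyENorm_zero]; exact ENNReal.zero_lt_top⟩
  add_mem' := by
    rintro f g ⟨hf, hf'⟩ ⟨hg, hg'⟩
    refine ⟨?_, (hardyENorm_add_le hp.out hf.continuous hg.continuous).trans_lt
      (ENNReal.add_lt_top.2 ⟨hf', hg'⟩)⟩
    obtain ⟨F, hF, h⟩ := hf
    obtain ⟨G, hG, h'⟩ := hg
    exact ⟨F + G, hF.add hG, fun z => by simp [h, h']⟩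
  smul_mem' := by
    rintro c f ⟨hf, hf'⟩
    refine ⟨?_, by
      rw [hardyENorm_smul]; exact ENNReal.mul_lt_top enorm_lt_top hf'⟩
    obtain ⟨F, hF, h⟩ := hf
    exact ⟨c • F, hF.const_smul c, fun z => by simp [h]⟩

/-- The Hardy space `H^p` of the unit disc. -/
def Hardy (p : ℝ≥0∞) [Fact (1 ≤ p)] : Type := hardySubmodule p

variable {p : ℝ≥0∞} [Fact (1 ≤ p)]

instance : AddCommGroup (Hardy p) := inferInstanceAs (AddCommGroup (hardySubmodule p))

instance : Module ℂ (Hardy p) := inferInstanceAs (Module ℂ (hardySubmodule p))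

instance : CoeFun (Hardy p) (fun _ => 𝔻 → ℂ) := ⟨fun f => (f : hardySubmodule p).1⟩

instance : Norm (Hardy p) := ⟨fun f => (hardyENorm p f).toReal⟩

lemma Hardy.norm_smul' (c : ℂ) (f : Hardy p) : ‖c • f‖ = ‖c‖ * ‖f‖ := by
  change (hardyENorm p (c • (f : 𝔻 → ℂ))).toReal = _
  rw [hardyENorm_smul, ENNReal.toReal_mul, toReal_enorm]
  rfl

/-- The norm of `H^p`, as a group norm. -/
def hardyGroupNorm (p : ℝ≥0∞) [hp : Fact (1 ≤ p)] : AddGroupNorm (Hardy p) where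
  toFun f := ‖f‖
  map_zero' := by
    change (hardyENorm p 0).toReal = 0
    rw [hardyENorm_zero, ENNReal.toReal_zero]
  add_le' f g := by
    change (hardyENorm p ((f : 𝔻 → ℂ) + (g : 𝔻 → ℂ))).toReal ≤
      (hardyENorm p f).toReal + (hardyENorm p g).toReal
    rw [← ENNReal.toReal_add f.2.2.ne g.2.2.ne]
    exact ENNReal.toReal_mono (ENNReal.add_lt_top.2 ⟨f.2.2, g.2.2⟩).ne
      (hardyENorm_add_le hp.out f.2.1.continuous g.2.1.continuous)
  neg' f := by
    have := Hardy.norm_smul' (-1) f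
    simpa using this
  eq_zero_of_map_eq_zero' f h := by
    have h' : hardyENorm p f = 0 :=
      ((ENNReal.toReal_eq_zero_iff _).1 h).resolve_right f.2.2.ne
    exact Subtype.ext (eq_zero_of_hardyENorm hp.out f.2.1.continuous h')

instance : NormedAddCommGroup (Hardy p) := (hardyGroupNorm p).toNormedAddCommGroup

instance : NormedSpace ℂ (Hardy p) := ⟨fun c f => (Hardy.norm_smul' c f).le⟩

/-! ### Automorphisms of the disc -/

/-- A holomorphic automorphism `φ(z) = lam * (z - a) / (1 - conj a * z)` of the disc, given by
its parameters `a ∈ 𝔻` and `lam ∈ T` (which are determined by `φ`). -/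
structure DiscAut where
  /-- the unimodular factor -/
  lam : Circle
  /-- the zero -/
  a : 𝔻

namespace DiscAut

/-- The formula of the automorphism, used on the closed disc. -/
def toFun (φ : DiscAut) (z : ℂ) : ℂ :=
  (φ.lam : ℂ) * (z - φ.a) / (1 - conj (φ.a : ℂ) * z)

lemma norm_toFun_lt_one (φ : DiscAut) (z : 𝔻) : ‖φ.toFun z‖ < 1 := by
  have ha := φ.a.normSq_lt_one
  have hz := z.normSq_lt_one
  have hid : Complex.normSq (1 - conj (φ.a : ℂ) * z) - Complex.normSq ((z : ℂ) - φ.a) =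
      (1 - Complex.normSq (φ.a : ℂ)) * (1 - Complex.normSq (z : ℂ)) := by
    simp [Complex.normSq_apply]
    ring
  have hlt : Complex.normSq ((z : ℂ) - φ.a) < Complex.normSq (1 - conj (φ.a : ℂ) * z) := by
    nlinarith [mul_pos (sub_pos.2 ha) (sub_pos.2 hz)]
  rw [Complex.normSq_eq_norm_sq, Complex.normSq_eq_norm_sq] at hlt
  have hlt' := lt_of_pow_lt_pow_left₀ 2 (norm_nonneg _) hlt
  rw [toFun, norm_div, norm_mul, Circle.norm_coe, one_mul,
    div_lt_one ((norm_nonneg _).trans_lt hlt')]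
  exact hlt'

/-- The automorphism as a self-map of the disc. -/
def toMap (φ : DiscAut) (z : 𝔻) : 𝔻 :=
  Complex.UnitDisc.mk (φ.toFun z) (φ.norm_toFun_lt_one z)

/-- `φ` is hyperbolic: it is not the identity and has two distinct fixed points on the unit
circle. -/
def IsHyperbolic (φ : DiscAut) : Prop :=
  φ.toMap ≠ id ∧ ∃ w₁ w₂ : ℂ, ‖w₁‖ = 1 ∧ ‖w₂‖ = 1 ∧ w₁ ≠ w₂ ∧
    φ.toFun w₁ = w₁ ∧ φ.toFun w₂ = w₂

end DiscAut

/-! ### The operators, first as maps on arbitrary functions on the disc -/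

/-- Multiplication `M_F`. -/
def mulOp (F : 𝔻 → ℂ) (f : 𝔻 → ℂ) : 𝔻 → ℂ := fun z => F z * f z

/-- Composition `C_φ`. -/
def compOp (φ : DiscAut) (f : 𝔻 → ℂ) : 𝔻 → ℂ := fun z => f (φ.toMap z)

/-- `U_φ = M_w C_φ` with `w = (conj lam * φ')^(1/p)`, principal branch of the power. -/
def weightedCompOp (p : ℝ≥0∞) (φ : DiscAut) (f : 𝔻 → ℂ) : 𝔻 → ℂ :=
  mulOp (fun z => (conj (φ.lam : ℂ) * deriv φ.toFun z) ^ (1 / (p.toReal : ℂ))) (compOp φ f)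

/-! ### Isometries of codimension one and the Crownover property -/

/-- `S` is an isometry whose range has codimension one in `H^p`. -/
def IsCodimOneIsometry (S : Hardy p →L[ℂ] Hardy p) : Prop :=
  Isometry S ∧ Module.finrank ℂ (Hardy p ⧸ LinearMap.range (S : Hardy p →ₗ[ℂ] Hardy p)) = 1

/-- `S` is Crownover: a codimension one isometry with `⋂_{n ≥ 1} S^n H^p = (0)`. -/
def IsCrownover (S : Hardy p →L[ℂ] Hardy p) : Prop :=
  IsCodimOneIsometry S ∧ (⋂ n : ℕ, ⋂ _ : 1 ≤ n, Set.range (S ^ n : Hardy p →L[ℂ] Hardy p)) = {0}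

end HardyDisc

end

open HardyDisc

noncomputable section

namespace HardyDisc

/-! ### Disc automorphisms on the closed disc -/

namespace DiscAut

variable (φ : DiscAut) {z : ℂ}

/-! Write `S = M_ψ U_φ` and let `b` be the zero of `ψ`.

`U_φ` is a surjective isometry: on the unit circle `|φ'|` is the Poisson kernel at `φ.a`, which is
also the derivative of the angular lift of `φ`, so the weight exactly compensates the change of
variables, and `U` of the inverse automorphism inverts it. As the norm is a supremum over interior
circles, the boundary identity is used only for dilates `F(s·)` and carried inside by
`circleNorm_mono` and Fatou's lemma. `M_ψ` is an isometry because `|ψ|` tends uniformly to `1` at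
the boundary, and its range consists of the functions vanishing at `b`. Hence the range of `S` is
the kernel of evaluation at `b`, of codimension one.

If `f = S g`, then `f(z)` is a nonzero multiple of `g(φ(z))` for `z ≠ b`. So if `f` vanishes on the
backward orbit of `b` and `b` is not periodic, `g` vanishes on the same orbit. By induction `f` lies
in the range of every `S^n` (`mem_range_pow`), and a single nonzero such `f` refutes the Crownover
property.

A half-plane coordinate `h` with the two fixed points at `0` and `∞` turns `φ` into `h ↦ μ h`, where
`0 < μ < 1` after a suitable choice of order (`exists_contracting`). Since `1 - |z|` is at most a
constant times `Re h(z)`, the orbit sums are dominated by geometric series. The required `f` need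
not be a Blaschke product: with `t = 2π / log μ` the function `E = h^{it}` is bounded, nonconstant
and invariant under `φ`, so `E - E(b)` vanishes on the whole orbit of `b`. -/

lemma re_denom_pos (hz : ‖z‖ ≤ 1) : 0 < (1 - conj (φ.a : ℂ) * z).re := by
  have h : ‖conj (φ.a : ℂ) * z‖ < 1 := by
    rw [norm_mul, RCLike.norm_conj]
    calc ‖(φ.a : ℂ)‖ * ‖z‖ ≤ ‖(φ.a : ℂ)‖ * 1 := by gcongr
      _ < 1 := by simpa using φ.a.norm_lt_one
  have := (Complex.re_le_norm (conj (φ.a : ℂ) * z)).trans_lt h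
  rw [Complex.sub_re, Complex.one_re]
  linarith

lemma denom_ne_zero (hz : ‖z‖ ≤ 1) : 1 - conj (φ.a : ℂ) * z ≠ 0 := by
  intro h
  have := φ.re_denom_pos hz
  simp [h] at this

lemma one_sub_sq_norm_a_pos : 0 < 1 - ‖(φ.a : ℂ)‖ ^ 2 := by
  linarith [φ.a.sq_norm_lt_one]

lemma conj_lam_mul_lam : conj (φ.lam : ℂ) * φ.lam = 1 := by
  rw [mul_comm, Complex.mul_conj, Circle.normSq_coe, Complex.ofReal_one]

lemma conj_a_mul_a : conj (φ.a : ℂ) * φ.a = ((‖(φ.a : ℂ)‖ ^ 2 : ℝ) : ℂ) := by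
  rw [mul_comm, Complex.mul_conj, Complex.normSq_eq_norm_sq]

lemma hasDerivAt_toFun (hz : ‖z‖ ≤ 1) :
    HasDerivAt φ.toFun
      ((φ.lam : ℂ) * ((1 - ‖(φ.a : ℂ)‖ ^ 2 : ℝ) * ((1 - conj (φ.a : ℂ) * z)⁻¹) ^ 2)) z := by
  have hd := φ.denom_ne_zero hz
  have h1 : HasDerivAt (fun w : ℂ => (φ.lam : ℂ) * (w - φ.a)) ((φ.lam : ℂ) * 1) z :=
    ((hasDerivAt_id z).sub_const _).const_mul _
  have h2 : HasDerivAt (fun w : ℂ => 1 - conj (φ.a : ℂ) * w) (-(conj (φ.a : ℂ) * 1)) z :=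
    ((hasDerivAt_id z).const_mul _).const_sub _
  refine (h1.div h2 hd).congr_deriv ?_
  have := φ.conj_a_mul_a
  push_cast at this ⊢
  field_simp
  rw [← this]
  ring

lemma conj_lam_mul_deriv (hz : ‖z‖ ≤ 1) :
    conj (φ.lam : ℂ) * deriv φ.toFun z =
      (1 - ‖(φ.a : ℂ)‖ ^ 2 : ℝ) * ((1 - conj (φ.a : ℂ) * z)⁻¹) ^ 2 := by
  rw [(φ.hasDerivAt_toFun hz).deriv, ← mul_assoc, conj_lam_mul_lam, one_mul]

lemma one_sub_sq_norm_toFun (hz : ‖z‖ ≤ 1) :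
    1 - ‖φ.toFun z‖ ^ 2 =
      (1 - ‖(φ.a : ℂ)‖ ^ 2) * (1 - ‖z‖ ^ 2) / ‖1 - conj (φ.a : ℂ) * z‖ ^ 2 := by
  have hd : ‖1 - conj (φ.a : ℂ) * z‖ ≠ 0 := norm_ne_zero_iff.2 (φ.denom_ne_zero hz)
  rw [toFun, norm_div, norm_mul, Circle.norm_coe, one_mul, div_pow, eq_div_iff (by positivity),
    sub_mul, div_mul_cancel₀ _ (by positivity), one_mul]
  simp only [← Complex.normSq_eq_norm_sq]
  simp [Complex.normSq_apply]
  ring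

lemma norm_toFun_le_one (hz : ‖z‖ ≤ 1) : ‖φ.toFun z‖ ≤ 1 := by
  have h := φ.one_sub_sq_norm_toFun hz
  have h' : 0 ≤ 1 - ‖φ.toFun z‖ ^ 2 := by
    rw [h]
    have := φ.one_sub_sq_norm_a_pos
    have : 0 ≤ 1 - ‖z‖ ^ 2 := by nlinarith [norm_nonneg z]
    positivity
  nlinarith [norm_nonneg (φ.toFun z)]

lemma norm_toFun_eq_one (hz : ‖z‖ = 1) : ‖φ.toFun z‖ = 1 := by
  have h := φ.one_sub_sq_norm_toFun hz.le
  rw [hz] at h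
  have h' : ‖φ.toFun z‖ ^ 2 = 1 ^ 2 := by
    have : 1 - ‖φ.toFun z‖ ^ 2 = 0 := by rw [h]; simp
    linarith
  exact (pow_left_inj₀ (norm_nonneg _) zero_le_one two_ne_zero).1 h'

@[simp] lemma coe_toMap (z : 𝔻) : (φ.toMap z : ℂ) = φ.toFun z := rfl

/-- The inverse automorphism. -/
def inverse : DiscAut where
  lam := φ.lam⁻¹
  a := -(φ.lam • φ.a)

lemma inverse_lam : (φ.inverse.lam : ℂ) = conj (φ.lam : ℂ) := by
  simp [inverse, ← Circle.coe_inv_eq_conj]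

lemma inverse_a : (φ.inverse.a : ℂ) = -((φ.lam : ℂ) * φ.a) := by
  simp [inverse]

lemma norm_inverse_a : ‖(φ.inverse.a : ℂ)‖ = ‖(φ.a : ℂ)‖ := by
  rw [inverse_a, norm_neg, norm_mul, Circle.norm_coe, one_mul]

/-- Source of both the inversion formula and the chain rule for the weights. -/
lemma inverse_denom (hz : ‖z‖ ≤ 1) :
    1 - conj (φ.inverse.a : ℂ) * φ.toFun z =
      (1 - ‖(φ.a : ℂ)‖ ^ 2 : ℝ) * (1 - conj (φ.a : ℂ) * z)⁻¹ := by
  have hd := φ.denom_ne_zero hz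
  have h1 := φ.conj_a_mul_a
  have h2 := φ.conj_lam_mul_lam
  rw [inverse_a, toFun]
  push_cast at h1 ⊢
  rw [← h1]
  simp only [map_neg, map_mul]
  field_simp
  linear_combination (conj (φ.a : ℂ) * (z - φ.a)) * h2

lemma inverse_toFun (hz : ‖z‖ ≤ 1) : φ.inverse.toFun (φ.toFun z) = z := by
  have hd := φ.denom_ne_zero hz
  have hd' : 1 - z * conj (φ.a : ℂ) ≠ 0 := by rwa [mul_comm]
  have hpos : ((1 - ‖(φ.a : ℂ)‖ ^ 2 : ℝ) : ℂ) ≠ 0 :=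
    Complex.ofReal_ne_zero.2 φ.one_sub_sq_norm_a_pos.ne'
  have h1 := φ.conj_a_mul_a
  have h2 := φ.conj_lam_mul_lam
  have hn : (φ.inverse.lam : ℂ) * (φ.toFun z - φ.inverse.a) =
      (1 - ‖(φ.a : ℂ)‖ ^ 2 : ℝ) * z * (1 - conj (φ.a : ℂ) * z)⁻¹ := by
    rw [inverse_lam, inverse_a, toFun]
    push_cast at h1 ⊢
    rw [← h1]
    field_simp
    linear_combination (z - conj (φ.a : ℂ) * φ.a * z) * h2
  rw [toFun, hn, φ.inverse_denom hz]
  field_simp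

lemma inverse_inverse : φ.inverse.inverse = φ := by
  have h1 : φ.inverse.inverse.lam = φ.lam := by simp [inverse]
  have h2 : φ.inverse.inverse.a = φ.a := by
    apply Complex.UnitDisc.coe_injective
    rw [inverse_a, inverse_a, inverse_lam]
    linear_combination (φ.a : ℂ) * φ.conj_lam_mul_lam
  cases φ
  simp only [inverse] at h1 h2 ⊢
  rw [h1, h2]

lemma inverse_toMap (z : 𝔻) : φ.inverse.toMap (φ.toMap z) = z :=
  Complex.UnitDisc.coe_injective (φ.inverse_toFun z.norm_lt_one.le)

lemma toMap_inverse (z : 𝔻) : φ.toMap (φ.inverse.toMap z) = z := by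
  have h := φ.inverse.inverse_toMap z
  rwa [inverse_inverse] at h

lemma differentiableOn_toFun : DifferentiableOn ℂ φ.toFun (Metric.closedBall 0 1) :=
  fun _ hz => (φ.hasDerivAt_toFun (by simpa using hz)).differentiableAt.differentiableWithinAt

/-! ### The weight -/

/-- The weight `(conj lam * φ')^(1/p)`. -/
def weight (p : ℝ≥0∞) (z : ℂ) : ℂ :=
  (conj (φ.lam : ℂ) * deriv φ.toFun z) ^ (1 / (p.toReal : ℂ))

/-- Squaring doubles an argument in `(-π/2, π/2)`, which stays off the cut. This makes the principal
power of `conj lam * φ'` analytic, and lets it commute with inversion. -/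
lemma mem_slitPlane_of_re_pos {c : ℝ} (hc : 0 < c) {u : ℂ} (hu : 0 < u.re) :
    (c : ℂ) * u ^ 2 ∈ Complex.slitPlane := by
  rw [Complex.mem_slitPlane_iff]
  by_cases h : u.im = 0
  · left
    have : ((c : ℂ) * u ^ 2).re = c * (u.re * u.re) := by simp [pow_two, h]
    rw [this]
    positivity
  · right
    have : ((c : ℂ) * u ^ 2).im = 2 * (c * (u.re * u.im)) := by simp [pow_two]; ring
    rw [this]
    simp [hc.ne', hu.ne', h]

lemma conj_lam_mul_deriv_mem_slitPlane (hz : ‖z‖ ≤ 1) :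
    conj (φ.lam : ℂ) * deriv φ.toFun z ∈ Complex.slitPlane := by
  rw [φ.conj_lam_mul_deriv hz]
  refine mem_slitPlane_of_re_pos φ.one_sub_sq_norm_a_pos ?_
  rw [Complex.inv_re]
  have h := φ.re_denom_pos hz
  exact div_pos h (Complex.normSq_pos.2 (φ.denom_ne_zero hz))

lemma weight_ne_zero (p : ℝ≥0∞) (hz : ‖z‖ ≤ 1) : φ.weight p z ≠ 0 := by
  rw [weight, Ne, Complex.cpow_eq_zero_iff]
  exact fun h => Complex.slitPlane_ne_zero (φ.conj_lam_mul_deriv_mem_slitPlane hz) h.1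

lemma differentiableOn_weight (p : ℝ≥0∞) :
    DifferentiableOn ℂ (φ.weight p) (Metric.closedBall 0 1) := by
  have h : DifferentiableOn ℂ (fun z : ℂ =>
      ((1 - ‖(φ.a : ℂ)‖ ^ 2 : ℝ) * ((1 - conj (φ.a : ℂ) * z)⁻¹) ^ 2 : ℂ) ^
        (1 / (p.toReal : ℂ))) (Metric.closedBall 0 1) := by
    refine DifferentiableOn.cpow_const (DifferentiableOn.const_mul (DifferentiableOn.pow
      (DifferentiableOn.inv (by fun_prop) fun z hz => φ.denom_ne_zero (by simpa using hz)) 2) _)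
      fun z hz => ?_
    have hz' : ‖z‖ ≤ 1 := by simpa using hz
    rw [← φ.conj_lam_mul_deriv hz']
    exact φ.conj_lam_mul_deriv_mem_slitPlane hz'
  refine h.congr fun z hz => ?_
  rw [weight, φ.conj_lam_mul_deriv (by simpa using hz)]

lemma weight_mul_weight_inverse (p : ℝ≥0∞) (hz : ‖z‖ ≤ 1) :
    φ.weight p z * φ.inverse.weight p (φ.toFun z) = 1 := by
  have h : conj (φ.inverse.lam : ℂ) * deriv φ.inverse.toFun (φ.toFun z) =
      (conj (φ.lam : ℂ) * deriv φ.toFun z)⁻¹ := by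
    have hpos : ((1 - ‖(φ.a : ℂ)‖ ^ 2 : ℝ) : ℂ) ≠ 0 :=
      Complex.ofReal_ne_zero.2 φ.one_sub_sq_norm_a_pos.ne'
    have hd := φ.denom_ne_zero hz
    rw [φ.inverse.conj_lam_mul_deriv (φ.norm_toFun_le_one hz), φ.conj_lam_mul_deriv hz,
      φ.inverse_denom hz, norm_inverse_a]
    field_simp
  have harg := Complex.slitPlane_arg_ne_pi (φ.conj_lam_mul_deriv_mem_slitPlane hz)
  rw [weight, weight, h, Complex.inv_cpow _ _ harg]
  exact mul_inv_cancel₀ (φ.weight_ne_zero p hz)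

/-- For `|z| = 1` one has `|1 - conj a z| = |z - a|`, which turns `|φ'|` into the Poisson kernel. -/
lemma norm_weight_rpow {p : ℝ≥0∞} (hp : p.toReal ≠ 0) (hz : ‖z‖ = 1) :
    ‖φ.weight p z‖ ^ p.toReal = poissonKernel 0 φ.a z := by
  have h1 : (1 / (p.toReal : ℂ)) = ((1 / p.toReal : ℝ) : ℂ) := by push_cast; rfl
  have h2 : ‖1 - conj (φ.a : ℂ) * z‖ = ‖z - φ.a‖ := by
    have : z * conj (1 - conj (φ.a : ℂ) * z) = z - φ.a := by
      have hzz : z * conj z = 1 := by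
        rw [Complex.mul_conj, Complex.normSq_eq_norm_sq, hz]; simp
      simp only [map_sub, map_one, map_mul, Complex.conj_conj]
      linear_combination (-(φ.a : ℂ)) * hzz
    rw [← this, norm_mul, hz, one_mul, RCLike.norm_conj]
  rw [weight, h1, Complex.norm_cpow_real, ← Real.rpow_mul (norm_nonneg _), one_div_mul_cancel hp,
    Real.rpow_one, φ.conj_lam_mul_deriv hz.le, norm_mul, norm_pow, norm_inv, h2,
    Complex.norm_real, Real.norm_of_nonneg φ.one_sub_sq_norm_a_pos.le, poissonKernel_def, sub_zero,
    sub_zero, hz, inv_pow, one_pow, div_eq_mul_inv]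

/-! ### Change of variables on the circle -/

lemma integral_poissonKernel {a : ℂ} (ha : ‖a‖ < 1) :
    ∫ θ in (0 : ℝ)..2 * Real.pi, poissonKernel 0 a (circleMap 0 1 θ) = 2 * Real.pi := by
  have h := (diffContOnCl_const (c := (1 : ℂ))).circleAverage_poissonKernel_smul
    (show a ∈ Metric.ball 0 1 by simpa using ha)
  rw [Real.circleAverage_def] at h
  simp only [Pi.smul_apply', Complex.real_smul, mul_one] at h
  rw [intervalIntegral.integral_ofReal, ← Complex.ofReal_mul] at h
  have h' := Complex.ofReal_eq_one.1 h
  field_simp at h'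
  linarith

lemma continuous_poissonKernel_circleMap {a : ℂ} (ha : ‖a‖ < 1) :
    Continuous fun θ : ℝ => poissonKernel 0 a (circleMap 0 1 θ) := by
  simp only [poissonKernel_def, sub_zero]
  refine Continuous.div (by fun_prop) (by fun_prop) fun θ => ?_
  have : ‖a‖ < ‖circleMap 0 1 θ‖ := by simpa using ha
  have h : circleMap 0 1 θ - a ≠ 0 := sub_ne_zero.2 fun h => by simp [← h] at this
  positivity

/-- Integrating the Poisson kernel gives the lift; its total mass `2π` says that `φ` winds once
round the circle. -/
lemma exists_angular_lift :
    ∃ Θ : ℝ → ℝ, (∀ θ, HasDerivAt Θ (poissonKernel 0 φ.a (circleMap 0 1 θ)) θ) ∧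
      (∀ θ, φ.toFun (circleMap 0 1 θ) = circleMap 0 1 (Θ θ)) ∧
      Θ (2 * Real.pi) = Θ 0 + 2 * Real.pi := by
  set k : ℝ → ℝ := fun θ => poissonKernel 0 φ.a (circleMap 0 1 θ) with hk
  have hkc : Continuous k := continuous_poissonKernel_circleMap φ.a.norm_lt_one
  set Θ : ℝ → ℝ := fun θ => (φ.toFun 1).arg + ∫ t in (0 : ℝ)..θ, k t with hΘ
  have hd : ∀ θ, HasDerivAt Θ (k θ) θ := fun θ =>
    (intervalIntegral.integral_hasDerivAt_right (hkc.intervalIntegrable _ _)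
      (hkc.stronglyMeasurableAtFilter _ _) hkc.continuousAt).const_add _
  refine ⟨Θ, hd, fun θ => ?_, by simp [hΘ, hk, integral_poissonKernel φ.a.norm_lt_one]⟩
  -- The quotient of the two sides has zero derivative, and the constant `arg (φ 1)` in `Θ` makes it
  -- `1` at `θ = 0`.
  set q : ℝ → ℂ := fun θ => φ.toFun (circleMap 0 1 θ) * circleMap 0 1 (-Θ θ) with hq
  have hqd : ∀ θ, HasDerivAt q 0 θ := by
    intro θ
    set z := circleMap 0 1 θ with hz
    have hz1 : ‖z‖ = 1 := by simp [hz]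
    have hzz : conj z * z = 1 := by
      rw [mul_comm, Complex.mul_conj, Complex.normSq_eq_norm_sq, hz1]; simp
    have hza : z - φ.a ≠ 0 := sub_ne_zero.2 fun h => by
      have := φ.a.norm_lt_one
      rw [← h, hz1] at this
      exact lt_irrefl _ this
    have h1 := (φ.hasDerivAt_toFun hz1.le).comp θ (hasDerivAt_circleMap 0 1 θ)
    have h2 := HasDerivAt.scomp θ (hasDerivAt_circleMap 0 1 (-Θ θ)) (hd θ).fun_neg
    refine (h1.mul h2).congr_deriv ?_
    have hdn := φ.denom_ne_zero hz1.le
    have hkk : (k θ : ℂ) = (1 - ‖(φ.a : ℂ)‖ ^ 2 : ℝ) * z /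
        ((z - φ.a) * (1 - conj (φ.a : ℂ) * z)) := by
      simp only [hk, poissonKernel_def, sub_zero, ← hz, hz1, one_pow]
      rw [← Complex.normSq_eq_norm_sq (z - φ.a)]
      rw [Complex.ofReal_div, ← Complex.mul_conj]
      have : (1 - conj (φ.a : ℂ) * z) = z * conj (z - φ.a) := by
        rw [map_sub]; linear_combination -hzz
      rw [this] at hdn ⊢
      have := right_ne_zero_of_mul hdn
      have := left_ne_zero_of_mul hdn
      field_simp
    simp only [Function.comp_apply, circleMap_zero, Complex.real_smul, ← hz] at *
    push_cast
    rw [hkk, toFun]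
    push_cast
    field_simp
    ring
  have hconst : ∀ x y, q x = q y := is_const_of_deriv_eq_zero
    (fun θ => (hqd θ).differentiableAt) (fun θ => (hqd θ).deriv)
  have hq0 : q θ = 1 := by
    rw [hconst θ 0]
    have h1 : ‖φ.toFun 1‖ = 1 := φ.norm_toFun_eq_one (by simp)
    have h2 := Complex.norm_mul_exp_arg_mul_I (φ.toFun 1)
    rw [h1, Complex.ofReal_one, one_mul] at h2
    have h0 : circleMap 0 1 0 = 1 := by simp [circleMap]
    have h00 : Θ 0 = (φ.toFun 1).arg := by simp [hΘ]
    simp only [hq, h0, h00]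
    nth_rw 1 [← h2]
    rw [circleMap_zero, Complex.ofReal_one, one_mul, ← Complex.exp_add]
    simp
  have hm : circleMap 0 1 (-Θ θ) * circleMap 0 1 (Θ θ) = 1 := by
    rw [circleMap_zero, circleMap_zero, Complex.ofReal_one, one_mul, one_mul, ← Complex.exp_add]
    simp
  calc φ.toFun (circleMap 0 1 θ) = q θ * circleMap 0 1 (Θ θ) := by
        simp only [hq]; rw [mul_assoc, hm, mul_one]
    _ = _ := by rw [hq0, one_mul]

lemma integral_comp_toFun {F : ℂ → ℝ} (hF : Continuous fun θ : ℝ => F (circleMap 0 1 θ)) :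
    ∫ θ in (0 : ℝ)..2 * Real.pi,
        F (φ.toFun (circleMap 0 1 θ)) * poissonKernel 0 φ.a (circleMap 0 1 θ) =
      ∫ θ in (0 : ℝ)..2 * Real.pi, F (circleMap 0 1 θ) := by
  obtain ⟨Θ, h1, h2, h3⟩ := φ.exists_angular_lift
  have h := intervalIntegral.integral_comp_mul_deriv (a := 0) (b := 2 * Real.pi)
    (fun x _ => h1 x) (continuous_poissonKernel_circleMap φ.a.norm_lt_one).continuousOn hF
  simp only [Function.comp_def, ← h2] at h
  have hper : Function.Periodic (fun θ : ℝ => F (circleMap 0 1 θ)) (2 * Real.pi) :=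
    fun θ => by simp only [periodic_circleMap 0 1 θ]
  rw [h, h3, hper.intervalIntegral_add_eq _ 0, zero_add]

end DiscAut

/-! ### `L^p` means over circles and the maximum principle -/

instance : IsFiniteMeasure circleMeasure := by
  unfold circleMeasure
  exact MeasureTheory.Measure.smul_finite _ ENNReal.ofReal_ne_top

lemma coe_circlePt (r : Set.Ioo (0 : ℝ) 1) (θ : ℝ) :
    (circlePt r θ : ℂ) = (r : ℝ) * circleMap 0 1 θ := by
  simp [circlePt, circleMap]

lemma integral_circleMeasure (F : ℝ → ℝ) :
    ∫ θ, F θ ∂circleMeasure = (2 * Real.pi)⁻¹ * ∫ θ in (0 : ℝ)..2 * Real.pi, F θ := by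
  have h : (0 : ℝ) ≤ (2 * Real.pi)⁻¹ := by positivity
  rw [circleMeasure, integral_smul_measure, ENNReal.toReal_ofReal h,
    intervalIntegral.integral_of_le (by positivity), smul_eq_mul]

lemma memLp_circleMeasure {h : ℝ → ℂ} (hh : Continuous h) (p : ℝ≥0∞) :
    MemLp h p circleMeasure := by
  obtain ⟨C, hC⟩ := isCompact_Icc.exists_bound_of_continuousOn
    (s := Set.Icc 0 (2 * Real.pi)) hh.continuousOn
  refine MemLp.of_bound hh.aestronglyMeasurable C ?_
  refine Measure.ae_smul_measure ?_ _
  exact (ae_restrict_mem measurableSet_Ioc).mono fun θ hθ => hC θ (Set.Ioc_subset_Icc_self hθ)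

lemma eLpNorm_circleMeasure {p : ℝ≥0∞} (hp : p ≠ 0) (hp' : p ≠ ∞) {h : ℝ → ℂ}
    (hh : Continuous h) :
    eLpNorm h p circleMeasure = ENNReal.ofReal
      (((2 * Real.pi)⁻¹ * ∫ θ in (0 : ℝ)..2 * Real.pi, ‖h θ‖ ^ p.toReal) ^ p.toReal⁻¹) := by
  rw [(memLp_circleMeasure hh p).eLpNorm_eq_integral_rpow_norm hp hp', integral_circleMeasure]

/-- The `L^p` norm on the circle is rotation invariant. -/
lemma eLpNorm_circleMap_rotate {p : ℝ≥0∞} (hp : p ≠ 0) (hp' : p ≠ ∞) {g : ℂ → ℂ}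
    (hg : Continuous g) {z : ℂ} (hz : ‖z‖ = 1) :
    eLpNorm (fun θ => g (z * circleMap 0 1 θ)) p circleMeasure =
      eLpNorm (fun θ => g (circleMap 0 1 θ)) p circleMeasure := by
  rw [eLpNorm_circleMeasure hp hp' (by fun_prop), eLpNorm_circleMeasure hp hp' (by fun_prop)]
  -- A rotation is the automorphism with `a = 0`, whose Poisson kernel is `1`.
  have h := DiscAut.integral_comp_toFun ⟨⟨z, by simpa [Submonoid.unitSphere] using hz⟩, 0⟩
    (F := fun w => ‖g w‖ ^ p.toReal)
    (Continuous.rpow_const (by fun_prop) fun _ => Or.inr ENNReal.toReal_nonneg)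
  simp [DiscAut.toFun, poissonKernel_def] at h
  simp [h]

/-- The continuous function `ζ ↦ ζ ^ n` on the circle. -/
def circlePow (n : ℕ) : C(Circle, ℂ) := ⟨fun ζ => (ζ : ℂ) ^ n, by fun_prop⟩

lemma norm_circlePow_le (n : ℕ) : ‖circlePow n‖ ≤ 1 :=
  (ContinuousMap.norm_le _ zero_le_one).2 fun ζ => by
    simp [circlePow, Circle.norm_coe]

/-- The dilates and rotations `ζ ↦ g (z ζ)` of `g`, as a function of `z`. -/
def dilation (g : C(ℂ, ℂ)) : C(ℂ, C(Circle, ℂ)) :=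
  ContinuousMap.curry ⟨fun x : ℂ × Circle => g (x.1 * x.2), by fun_prop⟩

lemma dilation_apply (g : C(ℂ, ℂ)) (z : ℂ) (ζ : Circle) : dilation g z ζ = g (z * ζ) := rfl

/-- The Taylor series `∑ c_n z^n ζ^n` converges in the sup norm over `ζ`, uniformly for `|z| < r <
1`, so the dilation is analytic as a map into `C(Circle, ℂ)`. -/
lemma differentiableOn_dilation {g : C(ℂ, ℂ)}
    (hg : DifferentiableOn ℂ g (Metric.ball 0 1)) :
    DifferentiableOn ℂ (dilation g) (Metric.ball 0 1) := by
  intro z hz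
  refine DifferentiableAt.differentiableWithinAt ?_
  obtain ⟨r, hzr, hr1⟩ := exists_between (show ‖z‖ < 1 by simpa using hz)
  have hr0 : 0 < r := (norm_nonneg z).trans_lt hzr
  set c : ℕ → ℂ := fun n => ((n.factorial : ℂ))⁻¹ * iteratedDeriv n g 0 with hc
  have hsum : ∀ w : ℂ, ‖w‖ < 1 → HasSum (fun n => c n * w ^ n) (g w) := by
    intro w hw
    have h := Complex.hasSum_taylorSeries_on_ball hg (z := w) (by simpa using hw)
    refine h.congr_fun fun n => ?_
    simp only [hc, sub_zero, smul_eq_mul]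
    ring
  have hu : Summable fun n => ‖c n‖ * r ^ n := by
    have h := (hsum r (by rwa [Complex.norm_real, Real.norm_of_nonneg hr0.le])).summable.norm
    refine h.congr fun n => ?_
    rw [norm_mul, norm_pow, Complex.norm_real, Real.norm_of_nonneg hr0.le]
  have hb : ∀ (n : ℕ) (w : ℂ), w ∈ Metric.ball (0 : ℂ) r →
      ‖(c n * w ^ n) • circlePow n‖ ≤ ‖c n‖ * r ^ n := by
    intro n w hw
    have hw' : ‖w‖ ≤ r := by simpa using (Metric.mem_ball.1 hw).le
    rw [norm_smul, norm_mul, norm_pow]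
    calc ‖c n‖ * ‖w‖ ^ n * ‖circlePow n‖ ≤ ‖c n‖ * r ^ n * 1 := by
          gcongr
          exact norm_circlePow_le n
      _ = _ := mul_one _
  have hd := Complex.differentiableOn_tsum_of_summable_norm hu
    (F := fun n w => (c n * w ^ n) • circlePow n)
    (fun n => DifferentiableOn.smul_const (by fun_prop) _) Metric.isOpen_ball hb
  have hmem : Metric.ball (0 : ℂ) r ∈ nhds z := Metric.isOpen_ball.mem_nhds (by simpa using hzr)
  refine (hd.congr fun w hw => ?_).differentiableAt hmem
  have hs : Summable fun n => (c n * w ^ n) • circlePow n :=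
    Summable.of_norm_bounded hu fun n => hb n w hw
  ext ζ
  have hev := (ContinuousMap.evalCLM ℂ ζ).hasSum hs.hasSum
  have hw1 : ‖w * ζ‖ < 1 := by
    rw [norm_mul, Circle.norm_coe, mul_one]
    exact (by simpa using hw : ‖w‖ < r).trans hr1
  refine (hsum _ hw1).unique (hev.congr_fun fun n => ?_)
  simp [circlePow, mul_pow]
  ring

/-- The `L^p` mean over a circle in the disc is at most the mean over the unit circle. -/
lemma eLpNorm_mul_circleMap_le_of_continuous {p : ℝ≥0∞} [hp : Fact (1 ≤ p)] (hp' : p ≠ ∞)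
    {g : C(ℂ, ℂ)} (hg : DifferentiableOn ℂ g (Metric.ball 0 1)) {z : ℂ} (hz : ‖z‖ ≤ 1) :
    eLpNorm (fun θ => g (z * circleMap 0 1 θ)) p circleMeasure ≤
      eLpNorm (fun θ => g (circleMap 0 1 θ)) p circleMeasure := by
  have hp0 : p ≠ 0 := (zero_lt_one.trans_le hp.out).ne'
  let : MeasurableSpace Circle := borel Circle
  have : BorelSpace Circle := ⟨rfl⟩
  set μ : Measure Circle := circleMeasure.map Circle.exp with hμ
  have : IsFiniteMeasure μ := by rw [hμ]; infer_instance
  set T : C(Circle, ℂ) →L[ℂ] Lp ℂ p μ := ContinuousMap.toLp p μ ℂ with hT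
  -- An analytic `L^p`-valued map whose norm is constant on the unit circle by rotation invariance;
  -- the maximum modulus principle for `G` gives the claim.
  set G : ℂ → Lp ℂ p μ := fun w => T (dilation g w) with hG
  have hnorm : ∀ w, ‖G w‖ₑ = eLpNorm (fun θ => g (w * circleMap 0 1 θ)) p circleMeasure := by
    intro w
    rw [Lp.enorm_def, eLpNorm_congr_ae (ContinuousMap.coeFn_toLp μ _), hμ,
      eLpNorm_map_measure (dilation g w).continuous.aestronglyMeasurable
        Circle.exp.continuous.measurable.aemeasurable]
    refine congrArg (fun h => eLpNorm h p circleMeasure) (funext fun θ => ?_)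
    simp [dilation_apply, circleMap]
  have hd : DiffContOnCl ℂ G (Metric.ball 0 1) :=
    ⟨fun w hw => T.differentiableAt.comp_differentiableWithinAt w
        (differentiableOn_dilation hg w hw),
      (T.continuous.comp (dilation g).continuous).continuousOn⟩
  have hfr : ∀ w ∈ frontier (Metric.ball (0 : ℂ) 1), ‖G w‖ ≤ ‖G 1‖ := by
    intro w hw
    rw [frontier_ball _ one_ne_zero, mem_sphere_zero_iff_norm] at hw
    refine (enorm_le_iff_norm_le).1 ?_
    rw [hnorm, hnorm]
    simp only [one_mul]
    exact (eLpNorm_circleMap_rotate hp0 hp' g.continuous hw).le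
  have h := Complex.norm_le_of_forall_mem_frontier_norm_le Metric.isBounded_ball hd hfr (z := z)
    (by rw [closure_ball _ one_ne_zero]; simpa using hz)
  have h' := (enorm_le_iff_norm_le).2 h
  rw [hnorm, hnorm] at h'
  simpa only [one_mul] using h'

lemma eLpNorm_mul_circleMap_le {p : ℝ≥0∞} [hp : Fact (1 ≤ p)] (hp' : p ≠ ∞)
    {g : ℂ → ℂ} (hgc : ContinuousOn g (Metric.closedBall 0 1))
    (hg : DifferentiableOn ℂ g (Metric.ball 0 1)) {z : ℂ} (hz : ‖z‖ ≤ 1) :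
    eLpNorm (fun θ => g (z * circleMap 0 1 θ)) p circleMeasure ≤
      eLpNorm (fun θ => g (circleMap 0 1 θ)) p circleMeasure := by
  -- Tietze extension: `dilation` needs continuity on the whole plane, while only values on the
  -- closed disc matter.
  obtain ⟨G, hG⟩ := ContinuousMap.exists_restrict_eq (Metric.isClosed_closedBall (x := (0 : ℂ))
    (ε := 1)) ⟨_, hgc.domRestrict⟩
  have hGg : ∀ w : ℂ, ‖w‖ ≤ 1 → G w = g w := fun w hw =>
    DFunLike.congr_fun hG ⟨w, by simpa using hw⟩
  have h := eLpNorm_mul_circleMap_le_of_continuous hp' (g := G)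
    (hg.congr fun w hw => hGg w (by simpa using (Metric.mem_ball.1 hw).le)) hz
  have h1 : ∀ θ, G (circleMap 0 1 θ) = g (circleMap 0 1 θ) := fun θ => hGg _ (by simp)
  have h2 : ∀ θ, G (z * circleMap 0 1 θ) = g (z * circleMap 0 1 θ) :=
    fun θ => hGg _ (by simpa using hz)
  simpa only [h1, h2] using h

/-! ### Weighted composition on `H^p` -/

section Hardy

variable {p : ℝ≥0∞}

lemma weightedCompOp_apply (φ : DiscAut) (f : 𝔻 → ℂ) (z : 𝔻) :
    weightedCompOp p φ f z = φ.weight p z * f (φ.toMap z) := rfl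

lemma IsAnalytic.mul {f g : 𝔻 → ℂ} (hf : IsAnalytic f) (hg : IsAnalytic g) :
    IsAnalytic (mulOp f g) := by
  obtain ⟨F, hF, h⟩ := hf
  obtain ⟨G, hG, h'⟩ := hg
  exact ⟨F * G, hF.mul hG, fun z => by simp [mulOp, h, h']⟩

lemma isAnalytic_weight (φ : DiscAut) : IsAnalytic fun z : 𝔻 => φ.weight p z :=
  ⟨φ.weight p, (φ.differentiableOn_weight p).mono Metric.ball_subset_closedBall, fun _ => rfl⟩

lemma isAnalytic_toMap (φ : DiscAut) : IsAnalytic fun z : 𝔻 => (φ.toMap z : ℂ) :=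
  ⟨φ.toFun, φ.differentiableOn_toFun.mono Metric.ball_subset_closedBall, fun _ => rfl⟩

lemma IsAnalytic.compOp {f : 𝔻 → ℂ} (hf : IsAnalytic f) (φ : DiscAut) :
    IsAnalytic (compOp φ f) := by
  obtain ⟨F, hF, h⟩ := hf
  refine ⟨F ∘ φ.toFun, hF.comp (φ.differentiableOn_toFun.mono Metric.ball_subset_closedBall)
    fun z hz => ?_, fun z => h _⟩
  have h := φ.norm_toFun_lt_one (.mk z (by simpa using hz))
  simpa using h

lemma IsAnalytic.weightedCompOp {f : 𝔻 → ℂ} (hf : IsAnalytic f) (φ : DiscAut) :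
    IsAnalytic (weightedCompOp p φ f) :=
  (isAnalytic_weight φ).mul (hf.compOp φ)

lemma weightedCompOp_inverse (φ : DiscAut) (f : 𝔻 → ℂ) :
    weightedCompOp p φ (weightedCompOp p φ.inverse f) = f := by
  funext z
  rw [weightedCompOp_apply, weightedCompOp_apply, ← mul_assoc, DiscAut.coe_toMap,
    φ.weight_mul_weight_inverse p z.norm_lt_one.le, one_mul, φ.inverse_toMap]

lemma weightedCompOp_inverse_left (φ : DiscAut) (f : 𝔻 → ℂ) :
    weightedCompOp p φ.inverse (weightedCompOp p φ f) = f := by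
  have h := weightedCompOp_inverse (p := p) φ.inverse f
  rwa [φ.inverse_inverse] at h

variable [hp : Fact (1 ≤ p)]

/-- The `L^p` means of an analytic function increase with the radius. -/
lemma circleNorm_mono (hp' : p ≠ ∞) {f : 𝔻 → ℂ} (hf : IsAnalytic f)
    {r s : Set.Ioo (0 : ℝ) 1} (hrs : r ≤ s) : circleNorm p f r ≤ circleNorm p f s := by
  obtain ⟨F, hF, hFf⟩ := hf
  have hrs' : (r : ℝ) ≤ s := hrs
  have hs : ∀ w : ℂ, ‖w‖ ≤ 1 → (s : ℝ) * w ∈ Metric.ball (0 : ℂ) 1 := by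
    intro w hw
    rw [mem_ball_zero_iff, norm_mul, Complex.norm_real, Real.norm_of_nonneg s.2.1.le]
    nlinarith [s.2.1, s.2.2]
  have hd : DifferentiableOn ℂ (fun w => F ((s : ℝ) * w)) (Metric.closedBall 0 1) := by
    intro w hw
    have h1 := (hF.differentiableAt (Metric.isOpen_ball.mem_nhds (hs w (by simpa using hw))))
    exact (DifferentiableAt.comp (f := fun w : ℂ => ((s : ℝ) : ℂ) * w) w h1
      (by fun_prop)).differentiableWithinAt
  -- The circle of radius `r` for `F` is that of radius `r / s` for `F(s·)`, which is regular up to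
  -- the boundary.
  have h := eLpNorm_mul_circleMap_le (p := p) hp' hd.continuousOn
    (hd.mono Metric.ball_subset_closedBall) (z := ((r / s : ℝ) : ℂ)) (by
      rw [Complex.norm_real, Real.norm_of_nonneg (div_nonneg r.2.1.le s.2.1.le),
        div_le_one s.2.1]
      exact hrs')
  have hs0 : ((s : ℝ) : ℂ) ≠ 0 := Complex.ofReal_ne_zero.2 s.2.1.ne'
  simp only [circleNorm, hFf, coe_circlePt]
  refine le_of_eq_of_le (congrArg (fun h => eLpNorm h p circleMeasure) (funext fun θ => ?_)) h
  congr 1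
  push_cast
  field_simp

lemma eLpNorm_weight_mul_comp (hp' : p ≠ ∞) (φ : DiscAut) {g : ℂ → ℂ}
    (hg : ContinuousOn g (Metric.closedBall 0 1)) :
    eLpNorm (fun θ => φ.weight p (circleMap 0 1 θ) * g (φ.toFun (circleMap 0 1 θ))) p
        circleMeasure =
      eLpNorm (fun θ => g (circleMap 0 1 θ)) p circleMeasure := by
  have hp0 : p ≠ 0 := (zero_lt_one.trans_le hp.out).ne'
  have hmem : ∀ θ, circleMap 0 1 θ ∈ Metric.closedBall (0 : ℂ) 1 := fun θ => by simp
  have h1 : Continuous fun θ => g (circleMap 0 1 θ) :=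
    hg.comp_continuous (continuous_circleMap 0 1) hmem
  have h2 : Continuous fun θ => g (φ.toFun (circleMap 0 1 θ)) :=
    hg.comp_continuous (φ.differentiableOn_toFun.continuousOn.comp_continuous
      (continuous_circleMap 0 1) hmem) fun θ => by
        simpa using φ.norm_toFun_le_one (by simp)
  have h3 : Continuous fun θ => φ.weight p (circleMap 0 1 θ) :=
    (φ.differentiableOn_weight p).continuousOn.comp_continuous (continuous_circleMap 0 1) hmem
  rw [eLpNorm_circleMeasure hp0 hp' (h3.fun_mul h2), eLpNorm_circleMeasure hp0 hp' h1]
  have h := φ.integral_comp_toFun (F := fun w => ‖g w‖ ^ p.toReal)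
    (Continuous.rpow_const h1.norm fun _ => Or.inr ENNReal.toReal_nonneg)
  rw [← h]
  have h4 : ∀ θ, ‖φ.weight p (circleMap 0 1 θ) * g (φ.toFun (circleMap 0 1 θ))‖ ^ p.toReal =
      ‖g (φ.toFun (circleMap 0 1 θ))‖ ^ p.toReal * poissonKernel 0 φ.a (circleMap 0 1 θ) := by
    intro θ
    rw [norm_mul, Real.mul_rpow (norm_nonneg _) (norm_nonneg _),
      φ.norm_weight_rpow (ENNReal.toReal_ne_zero.2 ⟨hp0, hp'⟩) (by simp), mul_comm]
  simp only [h4]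

/-- `φ` does not preserve circles centred at `0`, so the means cannot be compared radius by radius.
Dilating `F` by `s n → 1` allows passage to the unit circle, where the change of variables is exact.
-/
lemma hardyENorm_weightedCompOp_le (hp' : p ≠ ∞) (φ : DiscAut) {f : 𝔻 → ℂ}
    (hf : IsAnalytic f) : hardyENorm p (weightedCompOp p φ f) ≤ hardyENorm p f := by
  refine iSup_le fun r => ?_
  have hUc := (hf.weightedCompOp (p := p) φ).continuous
  have hfc := hf.continuous
  obtain ⟨F, hF, hFf⟩ := hf
  set s : ℕ → Set.Ioo (0 : ℝ) 1 := fun n => ⟨((n : ℝ) + 1) / (n + 2), by positivity, by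
    rw [div_lt_one (by positivity)]; linarith⟩ with hs
  have hst : Filter.Tendsto (fun n => (s n : ℝ)) Filter.atTop (nhds 1) := by
    have h := (tendsto_one_div_add_atTop_nhds_zero_nat (𝕜 := ℝ)).comp
      (Filter.tendsto_add_atTop_nat 1)
    have h' := h.const_sub 1
    rw [sub_zero] at h'
    refine h'.congr fun n => ?_
    simp only [Function.comp, hs]
    push_cast
    field_simp
    ring
  have hmem : ∀ n, ∀ w : ℂ, ‖w‖ ≤ 1 → (s n : ℝ) * w ∈ Metric.ball (0 : ℂ) 1 := by
    intro n w hw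
    rw [mem_ball_zero_iff, norm_mul, Complex.norm_real, Real.norm_of_nonneg (s n).2.1.le]
    nlinarith [(s n).2.1, (s n).2.2]
  have hFd : ∀ n, DifferentiableOn ℂ (fun w => F ((s n : ℝ) * w)) (Metric.closedBall 0 1) := by
    intro n w hw
    have h1 := (hF.differentiableAt (Metric.isOpen_ball.mem_nhds (hmem n w (by simpa using hw))))
    exact (DifferentiableAt.comp (f := fun w : ℂ => ((s n : ℝ) : ℂ) * w) w h1
      (by fun_prop)).differentiableWithinAt
  set g : ℕ → ℂ → ℂ := fun n w => φ.weight p w * F ((s n : ℝ) * φ.toFun w) with hg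
  have hgd : ∀ n, DifferentiableOn ℂ (g n) (Metric.closedBall 0 1) := fun n =>
    (φ.differentiableOn_weight p).mul ((hFd n).comp φ.differentiableOn_toFun
      fun w hw => by simpa using φ.norm_toFun_le_one (by simpa using hw))
  have hle : ∀ n, eLpNorm (fun θ => g n ((r : ℝ) * circleMap 0 1 θ)) p circleMeasure ≤
      hardyENorm p f := by
    intro n
    refine (eLpNorm_mul_circleMap_le hp' (hgd n).continuousOn
      ((hgd n).mono Metric.ball_subset_closedBall) (z := ((r : ℝ) : ℂ)) ?_).trans ?_
    · rw [Complex.norm_real, Real.norm_of_nonneg r.2.1.le]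
      exact r.2.2.le
    · refine le_of_eq_of_le ?_ (le_iSup (circleNorm p f) (s n))
      simp only [hg, circleNorm, hFf, coe_circlePt]
      exact eLpNorm_weight_mul_comp hp' φ (g := fun w => F ((s n : ℝ) * w)) (hFd n).continuousOn
  have hrmem : ∀ θ, (r : ℝ) * circleMap 0 1 θ ∈ Metric.closedBall (0 : ℂ) 1 := by
    intro θ
    rw [← coe_circlePt]
    simpa using (circlePt r θ).norm_lt_one.le
  -- Fatou's lemma on the fixed circle of radius `r`, as `s n → 1`.
  refine (Lp.eLpNorm_lim_le_liminf_eLpNorm (f := fun n θ => g n ((r : ℝ) * circleMap 0 1 θ))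
    (fun n => ((hgd n).continuousOn.comp_continuous (by fun_prop)
      hrmem).aestronglyMeasurable) _ (Filter.Eventually.of_forall fun θ => ?_)).trans
    (Filter.liminf_le_of_frequently_le' (Filter.Frequently.of_forall hle))
  rw [weightedCompOp_apply, hFf, DiscAut.coe_toMap, ← coe_circlePt]
  have hz := φ.norm_toFun_lt_one (circlePt r θ)
  have hFc : ContinuousAt F (φ.toFun (circlePt r θ)) :=
    (hF.differentiableAt (Metric.isOpen_ball.mem_nhds (by simpa using hz))).continuousAt
  refine Filter.Tendsto.const_mul _ (hFc.tendsto.comp ?_)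
  have h1 : Filter.Tendsto (fun n => ((s n : ℝ) : ℂ)) Filter.atTop (nhds 1) := by
    exact_mod_cast (Complex.continuous_ofReal.tendsto 1).comp hst
  simpa using h1.mul_const (φ.toFun (circlePt r θ))

lemma hardyENorm_weightedCompOp (hp' : p ≠ ∞) (φ : DiscAut) {f : 𝔻 → ℂ}
    (hf : IsAnalytic f) : hardyENorm p (weightedCompOp p φ f) = hardyENorm p f := by
  refine le_antisymm (hardyENorm_weightedCompOp_le hp' φ hf) ?_
  have h := hardyENorm_weightedCompOp_le hp' φ.inverse (hf.weightedCompOp (p := p) φ)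
  rwa [weightedCompOp_inverse_left] at h

/-! ### Multiplication by an automorphism -/

lemma one_sub_le_norm_toFun (ψ : DiscAut) (z : 𝔻) :
    1 - (1 - ‖(z : ℂ)‖ ^ 2) / (1 - ‖(ψ.a : ℂ)‖) ^ 2 ≤ ‖ψ.toFun z‖ := by
  have h := ψ.one_sub_sq_norm_toFun z.norm_lt_one.le
  have h1 := ψ.norm_toFun_lt_one z
  have ha := ψ.a.norm_lt_one
  have hz : 0 ≤ 1 - ‖(z : ℂ)‖ ^ 2 := by linarith [z.sq_norm_lt_one]
  have hden : 1 - ‖(ψ.a : ℂ)‖ ≤ ‖1 - conj (ψ.a : ℂ) * z‖ := by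
    have h2 := norm_sub_norm_le (1 : ℂ) (conj (ψ.a : ℂ) * z)
    rw [norm_one, norm_mul, RCLike.norm_conj] at h2
    nlinarith [norm_nonneg (ψ.a : ℂ), z.norm_lt_one]
  have h3 : 1 - ‖ψ.toFun z‖ ^ 2 ≤ (1 - ‖(z : ℂ)‖ ^ 2) / (1 - ‖(ψ.a : ℂ)‖) ^ 2 := by
    rw [h]
    have : 0 < 1 - ‖(ψ.a : ℂ)‖ := by linarith
    gcongr
    nlinarith [sq_nonneg ‖(ψ.a : ℂ)‖]
  nlinarith [norm_nonneg (ψ.toFun z)]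

/-- For `r < s < 1`, monotonicity of the means gives `m(s) ‖f‖_r ≤ m(s) ‖f‖_s ≤ ‖ψ f‖_s`, where
`m(s) → 1` bounds `|ψ|` from below on the circle of radius `s`. -/
lemma hardyENorm_mulOp_toMap (hp' : p ≠ ∞) (ψ : DiscAut) {f : 𝔻 → ℂ} (hf : IsAnalytic f) :
    hardyENorm p (mulOp (fun z => (ψ.toMap z : ℂ)) f) = hardyENorm p f := by
  refine le_antisymm (iSup_mono fun r => eLpNorm_mono fun θ => ?_) (iSup_le fun r => ?_)
  · rw [mulOp, norm_mul]
    exact mul_le_of_le_one_left (norm_nonneg _) (ψ.toMap _).norm_lt_one.le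
  set m : ℝ → ℝ := fun s => 1 - (1 - s ^ 2) / (1 - ‖(ψ.a : ℂ)‖) ^ 2 with hm
  have hmt : Filter.Tendsto (fun s => ENNReal.ofReal (m s) * circleNorm p f r)
      (nhdsWithin 1 (Set.Iio 1)) (nhds (circleNorm p f r)) := by
    have h1 : Filter.Tendsto m (nhdsWithin 1 (Set.Iio 1)) (nhds (m 1)) :=
      (Continuous.tendsto (by fun_prop) 1).mono_left nhdsWithin_le_nhds
    have h2 := ENNReal.Tendsto.mul_const (ENNReal.tendsto_ofReal h1) (b := circleNorm p f r)
      (Or.inl (by simp [hm]))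
    simpa [hm] using h2
  refine le_of_tendsto hmt ?_
  filter_upwards [Ioo_mem_nhdsLT r.2.2] with s hs
  set s' : Set.Ioo (0 : ℝ) 1 := ⟨s, r.2.1.trans hs.1, hs.2⟩ with hs'
  rcases le_or_gt (m s) 0 with h0 | h0
  · rw [ENNReal.ofReal_of_nonpos h0, zero_mul]
    exact bot_le
  calc ENNReal.ofReal (m s) * circleNorm p f r
      ≤ ENNReal.ofReal (m s) * circleNorm p f s' := by
        gcongr
        exact circleNorm_mono hp' hf hs.1.le
    _ = ‖((m s : ℝ) : ℂ)‖ₑ * circleNorm p f s' := by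
        rw [← ofReal_norm, Complex.norm_real, Real.norm_of_nonneg h0.le]
    _ = eLpNorm (fun θ => ((m s : ℝ) : ℂ) • f (circlePt s' θ)) p circleMeasure :=
        (eLpNorm_const_smul _ (fun θ => f (circlePt s' θ)) p circleMeasure).symm
    _ ≤ circleNorm p (mulOp (fun z => (ψ.toMap z : ℂ)) f) s' := by
        refine eLpNorm_mono fun θ => ?_
        rw [mulOp, norm_mul, norm_smul, Complex.norm_real, Real.norm_of_nonneg h0.le]
        gcongr
        have h := one_sub_le_norm_toFun ψ (circlePt s' θ)
        have hn : ‖(circlePt s' θ : ℂ)‖ = s := by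
          rw [coe_circlePt, norm_mul, Complex.norm_real, Real.norm_of_nonneg s'.2.1.le]
          simp [hs']
        rwa [hn] at h
    _ ≤ _ := le_iSup (circleNorm p _) s'

/-- An analytic function vanishing at the zero of `ψ` is divisible by `ψ`. -/
lemma exists_eq_mulOp_toMap (ψ : DiscAut) {f : 𝔻 → ℂ} (hf : IsAnalytic f) (h0 : f ψ.a = 0) :
    ∃ h, IsAnalytic h ∧ f = mulOp (fun z => (ψ.toMap z : ℂ)) h := by
  obtain ⟨F, hF, hFf⟩ := hf
  have hF0 : F ψ.a = 0 := by rw [← hFf, h0]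
  have hmem : Metric.ball (0 : ℂ) 1 ∈ nhds (ψ.a : ℂ) :=
    Metric.isOpen_ball.mem_nhds (by simpa using ψ.a.norm_lt_one)
  have hd := (Complex.differentiableOn_dslope hmem).2 hF
  -- This is `f / ψ`, with the singularity at `ψ.a` removed by `dslope`.
  refine ⟨fun z => conj (ψ.lam : ℂ) * (1 - conj (ψ.a : ℂ) * z) * dslope F ψ.a z,
    ⟨fun z => conj (ψ.lam : ℂ) * (1 - conj (ψ.a : ℂ) * z) * dslope F ψ.a z,
      DifferentiableOn.mul (by fun_prop) hd, fun z => rfl⟩, funext fun z => ?_⟩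
  have h1 := sub_smul_dslope F (ψ.a : ℂ) z
  rw [hF0, sub_zero, ← hFf, smul_eq_mul] at h1
  have h2 := ψ.denom_ne_zero z.norm_lt_one.le
  have h3 := ψ.conj_lam_mul_lam
  simp only [mulOp, DiscAut.coe_toMap, DiscAut.toFun]
  rw [← h1]
  have h4 : (ψ.lam : ℂ) * (z - ψ.a) / (1 - conj (ψ.a : ℂ) * z) *
      (conj (ψ.lam : ℂ) * (1 - conj (ψ.a : ℂ) * z) * dslope F ψ.a z) =
      (conj (ψ.lam : ℂ) * ψ.lam) * ((z - ψ.a) * dslope F ψ.a z) *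
        ((1 - conj (ψ.a : ℂ) * z) / (1 - conj (ψ.a : ℂ) * z)) := by ring
  rw [h4, h3, div_self h2, one_mul, mul_one]

end Hardy

/-! ### The operator `M_ψ U_φ`: range, codimension and powers -/

section Operator

variable {p : ℝ≥0∞}

lemma hardyENorm_lt_top_of_bounded {f : 𝔻 → ℂ} {C : ℝ} (h : ∀ z, ‖f z‖ ≤ C) :
    hardyENorm p f < ∞ := by
  have h1 : hardyENorm p f ≤ eLpNorm (fun _ : ℝ => (C : ℂ)) p circleMeasure :=
    iSup_le fun r => eLpNorm_mono fun θ => by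
      rw [Complex.norm_real]
      exact (h _).trans (le_abs_self C)
  exact h1.trans_lt (memLp_const _).eLpNorm_lt_top

variable [hp : Fact (1 ≤ p)]

/-- The operator `M_ψ U_φ` on `H^p`. -/
def mulWeightedComp (hp' : p ≠ ∞) (ψ φ : DiscAut) : Hardy p →ₗᵢ[ℂ] Hardy p where
  toFun f := ⟨mulOp (fun z => (ψ.toMap z : ℂ)) (weightedCompOp p φ f),
    (isAnalytic_toMap ψ).mul (f.2.1.weightedCompOp φ), by
      rw [hardyENorm_mulOp_toMap hp' ψ (f.2.1.weightedCompOp φ),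
        hardyENorm_weightedCompOp hp' φ f.2.1]
      exact f.2.2⟩
  map_add' f g := Subtype.ext <| funext fun z => by
    change _ * (_ * (f (φ.toMap z) + g (φ.toMap z))) =
      _ * (_ * f (φ.toMap z)) + _ * (_ * g (φ.toMap z))
    rw [mul_add, mul_add]
  map_smul' c f := Subtype.ext <| funext fun z => by
    change _ * (_ * (c * f (φ.toMap z))) = c * (_ * (_ * f (φ.toMap z)))
    rw [mul_left_comm _ c, mul_left_comm _ c]
  norm_map' f := by
    change (hardyENorm p (mulOp (fun z => (ψ.toMap z : ℂ))
      (weightedCompOp p φ f))).toReal = (hardyENorm p f).toReal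
    rw [hardyENorm_mulOp_toMap hp' ψ (f.2.1.weightedCompOp φ),
      hardyENorm_weightedCompOp hp' φ f.2.1]

lemma coe_mulWeightedComp (hp' : p ≠ ∞) (ψ φ : DiscAut) (f : Hardy p) :
    (mulWeightedComp hp' ψ φ f : 𝔻 → ℂ) =
      mulOp (fun z => (ψ.toMap z : ℂ)) (weightedCompOp p φ f) := rfl

lemma mulWeightedComp_apply (hp' : p ≠ ∞) (ψ φ : DiscAut) (f : Hardy p) (z : 𝔻) :
    mulWeightedComp hp' ψ φ f z = ψ.toFun z * (φ.weight p z * f (φ.toMap z)) := rfl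

/-- Evaluation at a point of the disc. -/
def evalAt (p : ℝ≥0∞) [Fact (1 ≤ p)] (b : 𝔻) : Hardy p →ₗ[ℂ] ℂ where
  toFun f := f b
  map_add' _ _ := rfl
  map_smul' _ _ := rfl

/-- A bounded analytic function, as an element of `H^p`. -/
def ofBounded (p : ℝ≥0∞) [Fact (1 ≤ p)] (f : 𝔻 → ℂ) (hf : IsAnalytic f) {C : ℝ}
    (h : ∀ z, ‖f z‖ ≤ C) : Hardy p :=
  ⟨f, hf, hardyENorm_lt_top_of_bounded h⟩

lemma evalAt_surjective (b : 𝔻) : Function.Surjective (evalAt p b) := fun c =>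
  ⟨ofBounded p (fun _ => c) ⟨fun _ => c, differentiableOn_const c, fun _ => rfl⟩
    fun _ => le_rfl, rfl⟩

/-- Divide by `ψ`, then apply `U` of the inverse automorphism; both isometry identities keep the
norm finite. -/
lemma exists_mulWeightedComp_eq (hp' : p ≠ ∞) (ψ φ : DiscAut) {f : Hardy p}
    (h0 : f ψ.a = 0) : ∃ g, mulWeightedComp hp' ψ φ g = f := by
  obtain ⟨h, hh, hfh⟩ := exists_eq_mulOp_toMap ψ f.2.1 h0
  have hh' : hardyENorm p h < ∞ := by
    rw [← hardyENorm_mulOp_toMap hp' ψ hh, ← hfh]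
    exact f.2.2
  refine ⟨⟨weightedCompOp p φ.inverse h, hh.weightedCompOp _, ?_⟩, Subtype.ext ?_⟩
  · rw [hardyENorm_weightedCompOp hp' _ hh]
    exact hh'
  · change mulOp _ (weightedCompOp p φ (weightedCompOp p φ.inverse h)) = _
    rw [weightedCompOp_inverse]
    exact hfh.symm

lemma range_mulWeightedComp (hp' : p ≠ ∞) (ψ φ : DiscAut) :
    LinearMap.range (mulWeightedComp hp' ψ φ).toLinearMap = LinearMap.ker (evalAt p ψ.a) := by
  refine le_antisymm ?_ fun f hf => exists_mulWeightedComp_eq hp' ψ φ hf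
  rintro _ ⟨f, rfl⟩
  rw [LinearMap.mem_ker]
  change ψ.toFun ψ.a * _ = 0
  simp [DiscAut.toFun]

lemma isCodimOneIsometry_mulWeightedComp (hp' : p ≠ ∞) (ψ φ : DiscAut) :
    IsCodimOneIsometry (mulWeightedComp hp' ψ φ).toContinuousLinearMap := by
  refine ⟨(mulWeightedComp hp' ψ φ).isometry, ?_⟩
  have h : LinearMap.range ((mulWeightedComp hp' ψ φ).toContinuousLinearMap :
      Hardy p →ₗ[ℂ] Hardy p) = LinearMap.ker (evalAt p ψ.a) := range_mulWeightedComp hp' ψ φ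
  rw [h, ((evalAt p ψ.a).quotKerEquivOfSurjective (evalAt_surjective ψ.a)).finrank_eq,
    Module.finrank_self]

lemma DiscAut.toFun_ne_zero (ψ : DiscAut) {z : 𝔻} (hz : z ≠ ψ.a) : ψ.toFun z ≠ 0 :=
  div_ne_zero (mul_ne_zero (Circle.coe_ne_zero _)
    (sub_ne_zero.2 fun h => hz (Complex.UnitDisc.coe_injective h)))
    (ψ.denom_ne_zero z.norm_lt_one.le)

/-- A function vanishing on the backward orbit of the zero of `ψ` is in the range of every power
of `M_ψ U_φ`. -/
lemma mem_range_pow (hp' : p ≠ ∞) (ψ φ : DiscAut)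
    (horb : ∀ k, φ.inverse.toMap^[k + 1] ψ.a ≠ ψ.a) (n : ℕ) (f : Hardy p)
    (hf : ∀ k, f (φ.inverse.toMap^[k] ψ.a) = 0) :
    f ∈ Set.range ((mulWeightedComp hp' ψ φ).toContinuousLinearMap ^ n :
      Hardy p →L[ℂ] Hardy p) := by
  induction n generalizing f with
  | zero => exact ⟨f, rfl⟩
  | succ n ih =>
    obtain ⟨g, rfl⟩ := exists_mulWeightedComp_eq hp' ψ φ (hf 0)
    -- Evaluating `f = S g` at the backward iterate `k + 1` shows that `g` vanishes at the iterate
    -- `k`; `horb` rules out a zero of `ψ` there.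
    obtain ⟨g', hg'⟩ := ih g fun k => by
      have h := hf (k + 1)
      rw [mulWeightedComp_apply] at h
      have h1 := (mul_eq_zero.1 h).resolve_left (ψ.toFun_ne_zero (horb k))
      have h2 := (mul_eq_zero.1 h1).resolve_left
        (φ.weight_ne_zero p (Complex.UnitDisc.norm_lt_one _).le)
      rwa [Function.iterate_succ_apply', φ.toMap_inverse] at h2
    refine ⟨g', ?_⟩
    rw [pow_succ', mul_apply_eq_comp, hg']
    rfl

end Operator

/-! ### Hyperbolic automorphisms in the half-plane model -/

/-- The Möbius map of the disc onto the right half-plane sending `α` to `0` and `β` to `∞`. -/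
def halfPlaneMap (α β z : ℂ) : ℂ := (conj α * β - 1) * ((z - α) / (z - β))

lemma conj_mul_self_of_norm_eq_one {α : ℂ} (hα : ‖α‖ = 1) : conj α * α = 1 := by
  rw [mul_comm, Complex.mul_conj, Complex.normSq_eq_norm_sq, hα]; simp

section HalfPlane

variable {α β : ℂ} (hα : ‖α‖ = 1) (hβ : ‖β‖ = 1) (hαβ : α ≠ β)
include hα hβ

/-- The factor `conj α * β - 1` rotates the image onto the right half-plane, making the real part a
multiple of the Poisson kernel with pole `β`. -/
lemma re_halfPlaneMap {z : ℂ} (hz : z ≠ β) :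
    (halfPlaneMap α β z).re = (1 - (conj α * β).re) * (1 - ‖z‖ ^ 2) / ‖z - β‖ ^ 2 := by
  have hz' : z - β ≠ 0 := sub_ne_zero.2 hz
  have hα2 : α.re * α.re + α.im * α.im = 1 := by
    rw [← Complex.normSq_apply, Complex.normSq_eq_norm_sq, hα, one_pow]
  have hβ2 : β.re * β.re + β.im * β.im = 1 := by
    rw [← Complex.normSq_apply, Complex.normSq_eq_norm_sq, hβ, one_pow]
  have h1 : halfPlaneMap α β z =
      (conj α * β - 1) * (z - α) * conj (z - β) * ((‖z - β‖ ^ 2 : ℝ) : ℂ)⁻¹ := by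
    rw [← Complex.normSq_eq_norm_sq, ← Complex.mul_conj, halfPlaneMap]
    have : conj (z - β) ≠ 0 := by rwa [Ne, map_eq_zero]
    field_simp
  rw [h1, ← Complex.ofReal_inv, Complex.re_mul_ofReal, ← div_eq_mul_inv]
  congr 1
  rw [← Complex.normSq_eq_norm_sq, Complex.normSq_apply]
  simp
  linear_combination (-(β.re * z.re) - β.im * z.im + β.re ^ 2 + β.im ^ 2) * hα2 +
    (1 - α.re * z.re - α.im * z.im) * hβ2

include hαβ

lemma re_conj_mul_lt_one : (conj α * β).re < 1 := by
  have h1 : 0 < ‖α - β‖ ^ 2 := by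
    have : α - β ≠ 0 := sub_ne_zero.2 hαβ
    positivity
  have h2 : ‖α - β‖ ^ 2 = 2 - 2 * (conj α * β).re := by
    have hα2 : α.re * α.re + α.im * α.im = 1 := by
      rw [← Complex.normSq_apply, Complex.normSq_eq_norm_sq, hα, one_pow]
    have hβ2 : β.re * β.re + β.im * β.im = 1 := by
      rw [← Complex.normSq_apply, Complex.normSq_eq_norm_sq, hβ, one_pow]
    rw [← Complex.normSq_eq_norm_sq, Complex.normSq_apply]
    simp
    linear_combination hα2 + hβ2
  linarith

omit hα hαβ in
lemma coe_ne_of_norm_eq_one (z : 𝔻) : (z : ℂ) ≠ β := fun h =>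
  z.norm_ne_one (h ▸ hβ)

lemma re_halfPlaneMap_pos (z : 𝔻) : 0 < (halfPlaneMap α β z).re := by
  have hz := coe_ne_of_norm_eq_one hβ z
  have hz' : (z : ℂ) - β ≠ 0 := sub_ne_zero.2 hz
  rw [re_halfPlaneMap hα hβ hz]
  have h1 := re_conj_mul_lt_one hα hβ hαβ
  have h2 := z.sq_norm_lt_one
  have h3 : 0 < 1 - (conj α * β).re := by linarith
  have h4 : 0 < 1 - ‖(z : ℂ)‖ ^ 2 := by linarith
  positivity

lemma one_sub_norm_le_re_halfPlaneMap (z : 𝔻) :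
    1 - ‖(z : ℂ)‖ ≤ 4 / (1 - (conj α * β).re) * (halfPlaneMap α β z).re := by
  have hz := coe_ne_of_norm_eq_one hβ z
  have hz' : 0 < ‖(z : ℂ) - β‖ := norm_pos_iff.2 (sub_ne_zero.2 hz)
  have h1 := re_conj_mul_lt_one hα hβ hαβ
  have h3 : 0 < 1 - (conj α * β).re := by linarith
  have h4 : 0 ≤ 1 - ‖(z : ℂ)‖ ^ 2 := by linarith [z.sq_norm_lt_one]
  have h5 : ‖(z : ℂ) - β‖ ≤ 2 := by
    have := norm_sub_le (z : ℂ) β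
    linarith [z.norm_lt_one]
  have h6 : 4 / (1 - (conj α * β).re) * (halfPlaneMap α β z).re =
      (1 - ‖(z : ℂ)‖ ^ 2) * (4 / ‖(z : ℂ) - β‖ ^ 2) := by
    rw [re_halfPlaneMap hα hβ hz]
    field_simp
  have h7 : 1 ≤ 4 / ‖(z : ℂ) - β‖ ^ 2 := by
    rw [one_le_div (by positivity)]
    nlinarith
  rw [h6]
  nlinarith [norm_nonneg (z : ℂ), z.norm_lt_one]

omit hα hαβ in
lemma differentiableOn_halfPlaneMap :
    DifferentiableOn ℂ (halfPlaneMap α β) (Metric.ball 0 1) := by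
  refine DifferentiableOn.const_mul (DifferentiableOn.div (by fun_prop) (by fun_prop)
    fun z hz => sub_ne_zero.2 fun h => ?_) _
  rw [h] at hz
  simp [hβ] at hz

lemma deriv_halfPlaneMap_ne_zero (z : 𝔻) : deriv (halfPlaneMap α β) z ≠ 0 := by
  have hz := sub_ne_zero.2 (coe_ne_of_norm_eq_one hβ z)
  have h : HasDerivAt (halfPlaneMap α β) ((conj α * β - 1) *
      ((1 * ((z : ℂ) - β) - ((z : ℂ) - α) * 1) / ((z : ℂ) - β) ^ 2)) z :=
    (((hasDerivAt_id (z : ℂ)).sub_const α).div ((hasDerivAt_id (z : ℂ)).sub_const β)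
      hz).const_mul _
  rw [h.deriv]
  have h1 : conj α * β - 1 ≠ 0 := fun h => by
    have h1 := re_conj_mul_lt_one hα hβ hαβ
    rw [sub_eq_zero.1 h, Complex.one_re] at h1
    exact lt_irrefl _ h1
  have h2 : 1 * ((z : ℂ) - β) - ((z : ℂ) - α) * 1 = α - β := by ring
  rw [h2]
  exact mul_ne_zero h1 (div_ne_zero (sub_ne_zero.2 hαβ) (pow_ne_zero 2 hz))

/-- An automorphism with boundary fixed points `α ≠ β` acts on the half-plane as a dilation. -/
lemma exists_multiplier (φ : DiscAut) (hφα : φ.toFun α = α) (hφβ : φ.toFun β = β) :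
    ∃ μ : ℝ, 0 < μ ∧ (μ : ℂ) * (1 - conj (φ.a : ℂ) * α) = 1 - conj (φ.a : ℂ) * β ∧
      ∀ z : 𝔻, halfPlaneMap α β (φ.toMap z) = μ * halfPlaneMap α β z := by
  have hdα := φ.denom_ne_zero hα.le
  -- At a unimodular fixed point, conjugation multiplies `1 - conj a γ` by `conj lam`, independently
  -- of `γ`; hence the ratio `m` is real.
  have hfix : ∀ γ : ℂ, ‖γ‖ = 1 → φ.toFun γ = γ →
      1 - φ.a * conj γ = conj (φ.lam : ℂ) * (1 - conj (φ.a : ℂ) * γ) := by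
    intro γ hγ h
    have hd := φ.denom_ne_zero hγ.le
    rw [DiscAut.toFun, div_eq_iff hd] at h
    linear_combination (conj (φ.lam : ℂ) * conj γ) * h - (conj γ * (γ - φ.a)) *
      φ.conj_lam_mul_lam - (1 - conj (φ.lam : ℂ) * (1 - conj (φ.a : ℂ) * γ)) *
      conj_mul_self_of_norm_eq_one hγ
  have hα1 := hfix α hα hφα
  have hβ1 := hfix β hβ hφβ
  set m : ℂ := (1 - conj (φ.a : ℂ) * β) / (1 - conj (φ.a : ℂ) * α) with hm
  have hreal : conj m = m := by
    have hl : conj (φ.lam : ℂ) ≠ 0 := left_ne_zero_of_mul_eq_one φ.conj_lam_mul_lam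
    rw [hm, map_div₀]
    simp only [map_sub, map_one, map_mul, Complex.conj_conj]
    rw [hα1, hβ1, mul_div_mul_left _ _ hl]
  obtain ⟨μ, hμ⟩ := Complex.conj_eq_iff_real.1 hreal
  have hmap : ∀ z : 𝔻, halfPlaneMap α β (φ.toMap z) = μ * halfPlaneMap α β z := by
    intro z
    have hd := φ.denom_ne_zero z.norm_lt_one.le
    have hpos : ((1 - ‖(φ.a : ℂ)‖ ^ 2 : ℝ) : ℂ) ≠ 0 :=
      Complex.ofReal_ne_zero.2 φ.one_sub_sq_norm_a_pos.ne'
    -- Factorization of `φ z - φ γ`: the first factor does not involve `γ`, so it cancels in the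
    -- quotient defining `halfPlaneMap`.
    have hsub : ∀ γ : ℂ, ‖γ‖ = 1 → φ.toFun γ = γ → φ.toFun z - γ =
        (φ.lam * (1 - ‖(φ.a : ℂ)‖ ^ 2 : ℝ) / (1 - conj (φ.a : ℂ) * z)) *
          ((z - γ) / (1 - conj (φ.a : ℂ) * γ)) := by
      intro γ hγ h
      have hdγ := φ.denom_ne_zero hγ.le
      have hd' : 1 - z * conj (φ.a : ℂ) ≠ 0 := by rwa [mul_comm]
      have hdγ' : 1 - γ * conj (φ.a : ℂ) ≠ 0 := by rwa [mul_comm]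
      have haa := φ.conj_a_mul_a
      nth_rw 1 [← h]
      simp only [DiscAut.toFun]
      push_cast at haa ⊢
      rw [← haa]
      field_simp
      ring
    have hc : (φ.lam : ℂ) * (1 - ‖(φ.a : ℂ)‖ ^ 2 : ℝ) / (1 - conj (φ.a : ℂ) * z) ≠ 0 :=
      div_ne_zero (mul_ne_zero (Circle.coe_ne_zero _) hpos) hd
    rw [halfPlaneMap, DiscAut.coe_toMap, hsub α hα hφα, hsub β hβ hφβ, mul_div_mul_left _ _ hc,
      ← hμ, hm, halfPlaneMap, div_div_div_eq, mul_comm (_ - α), mul_div_mul_comm, mul_left_comm]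
  refine ⟨μ, ?_, by rw [← hμ, hm, div_mul_cancel₀ _ hdα], hmap⟩
  have h0 := congrArg Complex.re (hmap 0)
  rw [Complex.re_ofReal_mul] at h0
  have h1 := re_halfPlaneMap_pos hα hβ hαβ (φ.toMap 0)
  rw [h0] at h1
  exact (pos_iff_pos_of_mul_pos h1).2 (re_halfPlaneMap_pos hα hβ hαβ 0)

end HalfPlane

/-! ### Orbits of a hyperbolic automorphism -/

/-- Exchanging the fixed points inverts the multiplier, and multiplier `1` would force `a = 0` and
`lam = 1`, the identity. -/
lemma DiscAut.IsHyperbolic.exists_contracting {φ : DiscAut} (hφ : φ.IsHyperbolic) :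
    ∃ (α β : ℂ) (μ : ℝ), ‖α‖ = 1 ∧ ‖β‖ = 1 ∧ α ≠ β ∧ 0 < μ ∧ μ < 1 ∧
      ∀ z : 𝔻, halfPlaneMap α β (φ.toMap z) = μ * halfPlaneMap α β z := by
  obtain ⟨hid, α, β, hα, hβ, hαβ, hφα, hφβ⟩ := hφ
  obtain ⟨μ, hμ0, hμ, hmap⟩ := exists_multiplier hα hβ hαβ φ hφα hφβ
  rcases lt_trichotomy μ 1 with h | h | h
  · exact ⟨α, β, μ, hα, hβ, hαβ, hμ0, h, hmap⟩
  · exfalso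
    rw [h, Complex.ofReal_one, one_mul, sub_right_inj] at hμ
    have ha : (φ.a : ℂ) = 0 := by
      by_contra hne
      exact hαβ (mul_left_cancel₀ (by simpa using hne) hμ)
    have hl : (φ.lam : ℂ) = 1 := by
      simp only [DiscAut.toFun, ha, map_zero, zero_mul, sub_zero, div_one] at hφα
      have hα0 : α ≠ 0 := norm_ne_zero_iff.1 (by rw [hα]; exact one_ne_zero)
      exact (mul_eq_right₀ hα0).1 hφα
    refine hid (funext fun z => Complex.UnitDisc.coe_injective ?_)
    simp [DiscAut.toFun, ha, hl]
  · obtain ⟨ν, hν0, hν, hmap'⟩ := exists_multiplier hβ hα hαβ.symm φ hφβ hφα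
    refine ⟨β, α, ν, hβ, hα, hαβ.symm, hν0, ?_, hmap'⟩
    have h1 : (ν * μ : ℂ) = 1 := by
      refine mul_right_cancel₀ (φ.denom_ne_zero hα.le) ?_
      rw [mul_assoc, hμ, hν, one_mul]
    have h2 : ν * μ = 1 := by exact_mod_cast h1
    nlinarith

lemma summable_one_sub_norm_iterate {φ : DiscAut} (hφ : φ.IsHyperbolic) (c : 𝔻) :
    Summable fun n : ℕ => 1 - ‖((φ.toMap^[n] c : 𝔻) : ℂ)‖ := by
  obtain ⟨α, β, μ, hα, hβ, hαβ, hμ0, hμ1, hmap⟩ := hφ.exists_contracting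
  have hit : ∀ n : ℕ, (halfPlaneMap α β (φ.toMap^[n] c)).re =
      μ ^ n * (halfPlaneMap α β c).re := by
    intro n
    induction n with
    | zero => simp
    | succ n ih =>
      rw [Function.iterate_succ_apply', hmap, Complex.re_ofReal_mul, ih, pow_succ']
      ring
  refine Summable.of_nonneg_of_le (fun n => sub_nonneg.2 (Complex.UnitDisc.norm_lt_one _).le)
    (fun n => (one_sub_norm_le_re_halfPlaneMap hα hβ hαβ _).trans_eq ?_)
    (((summable_geometric_of_lt_one hμ0.le hμ1).mul_right
      (halfPlaneMap α β c).re).mul_left (4 / (1 - (conj α * β).re)))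
  rw [hit]

/-- For hyperbolic `φ` and `b` in the disc there is a nonzero bounded analytic function vanishing
on the whole backward orbit of `b`, and `b` is not periodic. -/
lemma exists_bounded_vanishing_on_orbit {φ : DiscAut} (hφ : φ.IsHyperbolic) (b : 𝔻) :
    (∀ k, φ.inverse.toMap^[k + 1] b ≠ b) ∧
      ∃ (f : 𝔻 → ℂ) (C : ℝ), IsAnalytic f ∧ (∀ z, ‖f z‖ ≤ C) ∧ f ≠ 0 ∧
        ∀ k, f (φ.inverse.toMap^[k] b) = 0 := by
  obtain ⟨α, β, μ, hα, hβ, hαβ, hμ0, hμ1, hmap⟩ := hφ.exists_contracting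
  set h := halfPlaneMap α β with hh
  have hre : ∀ z : 𝔻, 0 < (h z).re := re_halfPlaneMap_pos hα hβ hαβ
  have hne : ∀ z : 𝔻, h z ≠ 0 := fun z hz => by
    have := hre z
    simp [hz] at this
  have hinv : ∀ z : 𝔻, μ * h (φ.inverse.toMap z) = h z := fun z => by
    rw [← hmap, φ.toMap_inverse]
  refine ⟨fun k hk => ?_, ?_⟩
  · have hit : ∀ n : ℕ, (μ : ℂ) ^ n * h (φ.inverse.toMap^[n] b) = h b := by
      intro n
      induction n with
      | zero => simp
      | succ n ih => rw [Function.iterate_succ_apply', pow_succ, mul_assoc, hinv, ih]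
    have h1 := hit (k + 1)
    rw [hk, mul_eq_right₀ (hne b)] at h1
    have h2 : μ ^ (k + 1) = 1 := by exact_mod_cast h1
    exact (pow_lt_one₀ hμ0.le hμ1 (Nat.succ_ne_zero k)).ne h2
  have hlog : Real.log μ ≠ 0 := (Real.log_neg hμ0 hμ1).ne
  -- Chosen so that `μ^{it} = exp (2πi) = 1`, which makes `E = h^{it}` invariant under `φ`.
  set t : ℝ := 2 * Real.pi / Real.log μ with ht
  have ht0 : t ≠ 0 := div_ne_zero (by positivity) hlog
  set E : ℂ → ℂ := fun z => Complex.exp ((t * Complex.I) * Complex.log (h z)) with hE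
  have hperiod : ∀ z : 𝔻, E (φ.toMap z) = E z := by
    intro z
    simp only [hE]
    rw [hmap, Complex.log_ofReal_mul hμ0 (hne z), mul_add, Complex.exp_add]
    have h1 : (t * Complex.I) * (Real.log μ : ℂ) = 2 * Real.pi * Complex.I := by
      have : ((Real.log μ : ℝ) : ℂ) ≠ 0 := Complex.ofReal_ne_zero.2 hlog
      rw [ht]
      push_cast
      field_simp
    rw [h1, Complex.exp_two_pi_mul_I, one_mul]
  have hderiv : ∀ z : 𝔻, HasDerivAt E (E z * ((t * Complex.I) * (deriv h z / h z))) z := by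
    intro z
    have hz : Metric.ball (0 : ℂ) 1 ∈ nhds (z : ℂ) :=
      Metric.isOpen_ball.mem_nhds (by simpa using z.norm_lt_one)
    exact ((((differentiableOn_halfPlaneMap hβ).differentiableAt hz).hasDerivAt.clog
      (Complex.mem_slitPlane_iff.2 (Or.inl (hre z)))).const_mul _).cexp
  have hbound : ∀ z : 𝔻, ‖E z‖ ≤ Real.exp (|t| * Real.pi) := by
    intro z
    rw [hE, Complex.norm_exp]
    -- `|h^{it}| = exp (-t arg h)` is bounded because the argument is.
    have h1 : ((t * Complex.I) * Complex.log (h z)).re = -(t * (h z).arg) := by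
      simp [Complex.log_im]
    rw [h1]
    refine Real.exp_le_exp.2 ((neg_le_abs _).trans ?_)
    rw [abs_mul]
    gcongr
    exact Complex.abs_arg_le_pi _
  refine ⟨fun z => E z - E b, Real.exp (|t| * Real.pi) + Real.exp (|t| * Real.pi),
    ⟨fun z => E z - E b, fun z hz => ?_, fun _ => rfl⟩,
    fun z => (norm_sub_le _ _).trans (add_le_add (hbound z) (hbound b)), fun h0 => ?_, fun k => ?_⟩
  · exact ((hderiv (.mk z (by simpa using hz))).differentiableAt.sub_const
      _).differentiableWithinAt
  -- If `E` were constant, its derivative `E · it · h' / h` would vanish at `0`, but no factor does.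
  · have hconst : E =ᶠ[nhds ((0 : 𝔻) : ℂ)] fun _ => E b := by
      filter_upwards [Metric.isOpen_ball.mem_nhds
        (show ((0 : 𝔻) : ℂ) ∈ Metric.ball (0 : ℂ) 1 by simp)] with z hz
      exact sub_eq_zero.1 (congrFun h0 (.mk z (by simpa using hz)))
    have h1 := (hderiv 0).deriv
    rw [hconst.deriv_eq, deriv_const] at h1
    refine mul_ne_zero (Complex.exp_ne_zero _) (mul_ne_zero (mul_ne_zero
      (Complex.ofReal_ne_zero.2 ht0) Complex.I_ne_zero) (div_ne_zero
      (deriv_halfPlaneMap_ne_zero hα hβ hαβ 0) (hne 0))) h1.symm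
  · have hit : ∀ n : ℕ, E (φ.inverse.toMap^[n] b) = E b := by
      intro n
      induction n with
      | zero => rfl
      | succ n ih =>
        rw [Function.iterate_succ_apply', ← hperiod, φ.toMap_inverse, ih]
    exact sub_eq_zero.2 (hit k)

end HardyDisc

end

open HardyDisc
theorem proposition4 (p : ℝ≥0∞) [Fact (1 ≤ p)] (hp_top : p ≠ ∞) (hp_two : p ≠ 2)
    (φ ψ : DiscAut) (hφ : φ.IsHyperbolic) :
    (∀ c : 𝔻, Summable fun n : ℕ => 1 - ‖((φ.toMap^[n] c : 𝔻) : ℂ)‖) ∧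
    ∃ S : Hardy p →L[ℂ] Hardy p,
      (∀ f : Hardy p,
        (S f : 𝔻 → ℂ) = mulOp (fun z => (ψ.toMap z : ℂ)) (weightedCompOp p φ f)) ∧
      IsCodimOneIsometry S ∧ ¬ IsCrownover S := by
  refine ⟨summable_one_sub_norm_iterate hφ, (mulWeightedComp hp_top ψ φ).toContinuousLinearMap,
    coe_mulWeightedComp hp_top ψ φ, isCodimOneIsometry_mulWeightedComp hp_top ψ φ, ?_⟩
  rintro ⟨-, hcap⟩
  obtain ⟨horb, f, C, hf, hC, hf0, hfz⟩ := exists_bounded_vanishing_on_orbit hφ ψ.a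
  have hmem : ofBounded p f hf hC ∈ (⋂ n : ℕ, ⋂ _ : 1 ≤ n,
      Set.range ((mulWeightedComp hp_top ψ φ).toContinuousLinearMap ^ n :
        Hardy p →L[ℂ] Hardy p)) :=
    Set.mem_iInter₂.2 fun n _ => mem_range_pow hp_top ψ φ horb n _ hfz
  rw [hcap] at hmem
  exact hf0 (congrArg Subtype.val (Set.mem_singleton_iff.1 hmem))
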